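/- Let $\Theta=(\theta_m)_{m\ge 1}$ be a sequence of real numbers $\theta_m\ge 0$ and, for $n\in\mathbb N$, let $A_n\subseteq\{1,\dots,n\}$. Define $$h_n(A_n)=\frac1{n!}\sum_{\sigma\in S_n}\ \prod_{i=1}^{\ell}\theta_{\lambda_i}\mathbf 1_{\{\lambda_i\in A_n\}},$$ where $(\lambda_1,\dots,\lambda_\ell)$ is the cycle type of $\sigma$ (fixed points counting as cycles of length $1$); this is the normalization constant of the $A_n$-weighted measure $\sigma\mapsto \frac{1}{h_n(A_n)\,n!}\prod_i\theta_{\lambda_i}\mathbf 1_{\{\lambda_i\in A_n\}}$ on $S_n$. Put $D_n=\{1,\dots,n\}\setminus A_n$, $d_n=\max D_n$ if $D_n\ne\emptyset$ and $d_n=1$ otherwise, and $L_{D_n}(t)=\sum_{m\in D_n}\frac{\theta_m}{m}t^m$. For $r,\vartheta>0$ and $K\in\mathbb R$ let $\mathcal F(r,\vartheta,K)$ be the set of functions $g$ for which there are $R>r$ and $0<\phi<\pi/2$ such that $g$ is holomorphic in $\Delta_0=\{z\in\mathbb C: |z|<R,\ z\ne r,\ |\arg(z-r)|>\phi\}$ and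 $$g(t)=\vartheta\log\Bigl(\frac1{1-t/r}\Bigr)+K+O(t-r)\qquad (t\to r,\ t\in\Delta_0).$$ Suppose that the power series $g_\Theta(t)=\sum_{m\ge1}\frac{\theta_m}{m}t^m$ belongs to $\mathcal F(r,\vartheta,K)$, that is, it converges near $0$ and its sum continues analytically to an element of $\mathcal F(r,\vartheta,K)$. If for every $C\in\mathbb R$ $$C\log n-\frac n{d_n}\to-\infty\qquad(n\to\infty),\tag{$*$}$$ then, as $n\to\infty$, $$h_n(A_n)=\exp\bigl(-L_{D_n}(r)\bigr)\,\frac{n^{\vartheta-1}e^{K}}{r^n\,\Gamma(\vartheta)}\Bigl(1+O\Bigl(\frac{d_n}{n}\Bigr)\Bigr).$$ In particular, $(*)$ holds if $d_n\sim\log n$, or if $d_n\sim n^\alpha$ for some $0<\alpha<1$. -/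

import Mathlib

open Filter Topology Asymptotics

noncomputable section

namespace CycleWeights

/-- The product of `θ m * 1_{m ∈ A}` over the lengths `m` of all cycles of `σ`. The multiset
`σ.partition.parts` is the full cycle type, in which every fixed point counts as a cycle of
length `1`. -/
def weight (θ : ℕ → ℝ) (A : Finset ℕ) {n : ℕ} (σ : Equiv.Perm (Fin n)) : ℝ :=
  (σ.partition.parts.map fun m => if m ∈ A then θ m else 0).prod

/-- The normalization constant `h_n(A)`, for which
`σ ↦ weight θ A σ / (h_n(A) * n!)` has total mass one on the symmetric group
(as soon as `h_n(A) ≠ 0`). -/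
def normConst (θ : ℕ → ℝ) (n : ℕ) (A : Finset ℕ) : ℝ :=
  (∑ σ : Equiv.Perm (Fin n), weight θ A σ) / (n.factorial : ℝ)

/-- `D_n = {1, …, n} \ A_n`. -/
def compl (n : ℕ) (A : Finset ℕ) : Finset ℕ := Finset.Icc 1 n \ A

/-- `max D` if `D` is nonempty, and `1` otherwise. -/
def maxOrOne (D : Finset ℕ) : ℕ := if h : D.Nonempty then D.max' h else 1

/-- `L_D(t) = ∑_{m ∈ D} (θ_m / m) t ^ m`, for a finite set `D`. -/
def L (θ : ℕ → ℝ) (D : Finset ℕ) (t : ℝ) : ℝ := ∑ m ∈ D, θ m / (m : ℝ) * t ^ m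

/-- The domain `Δ₀(r, R, φ)`. -/
def Delta0 (r R φ : ℝ) : Set ℂ :=
  {z | ‖z‖ < R ∧ z ≠ (r : ℂ) ∧ φ < |Complex.arg (z - (r : ℂ))|}

/-- The class `F(r, ϑ, K)`: functions holomorphic in some `Δ₀(r, R, φ)` which satisfy
`g(t) = ϑ log (1 / (1 - t / r)) + K + O(t - r)` as `t → r` in that domain. -/
def classF (r ϑ K : ℝ) : Set (ℂ → ℂ) :=
  {g | ∃ R φ : ℝ, r < R ∧ 0 < φ ∧ φ < Real.pi / 2 ∧
    DifferentiableOn ℂ g (Delta0 r R φ) ∧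
    (fun t : ℂ => g t - ((ϑ : ℂ) * Complex.log (1 / (1 - t / (r : ℂ))) + (K : ℂ)))
      =O[𝓝[Delta0 r R φ] (r : ℂ)] fun t : ℂ => t - (r : ℂ)}

/-- `g_Θ ∈ F(r, ϑ, K)`: the function given near `0` by the convergent power series
`∑_{m ≥ 1} (θ_m / m) t ^ m` (indexed below by `m = k + 1`) continues analytically to a member of
`F(r, ϑ, K)`. -/
def GThetaMem (θ : ℕ → ℝ) (r ϑ K : ℝ) : Prop :=
  ∃ g ∈ classF r ϑ K, ∀ᶠ t : ℂ in 𝓝 0,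
    HasSum (fun k : ℕ => (θ (k + 1) : ℂ) / ((k + 1 : ℕ) : ℂ) * t ^ (k + 1)) (g t)

/-- The growth assumption: `C log n - n / d_n → -∞` for every real `C`. -/
def Growth (d : ℕ → ℕ) : Prop :=
  ∀ C : ℝ, Tendsto (fun n : ℕ => C * Real.log (n : ℝ) - (n : ℝ) / (d n : ℝ)) atTop atBot

end CycleWeights

end

/-! Replacing `θ m` by `θ m * r ^ m` reduces everything to `r = 1`. By the exponential formula
`h_n(A_n)` is then the coefficient of `z ^ n` in `exp (g z - L_D z)` with `D = D_n`; lengths above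
`n` do not affect it. Since `D` varies with `n`, singularity analysis has to be uniform over all `D
⊆ {1, …, d}`.

The comparison function is `e^K (1 - z)^(-ϑ)`, whose coefficients are `e^K n^(ϑ-1) / Γ(ϑ)` up to
`O(n^(ϑ-2))`. Subtracting it from `e^{L_D(1)} exp (g - L_D)` leaves `remainder`, which is controlled
in two regimes. At distance `O(1/d)` from `1`, the bound `∑_{m ≤ d} θ_m = O(d)` gives `L_D z - L_D 1
= O(d |1 - z|)`, so the remainder is `O(d |1 - z|^(1-ϑ))`. Farther away, but with `|z| ≤ e^{1/d}`,
the bound `∑_{m ≤ d} θ_m / m = O(1 + log d)` makes `exp (L_D 1 - L_D z)` at most a power of `d` up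
to a constant.

The contour runs from distance of order `1/n` to `|z| - 1` of order `1/d`. The near part contributes
`O(d n^(ϑ-2))`, a relative error `O(d/n)`. The far part contributes a power of `n` times `exp (-k n
/ d)`, which `(*)` makes smaller than any power of `n`.

In the coordinate `w = log z` the contour is three line segments in a disc, where the integrand has
a primitive `H`. The coefficient is an increment of `H`, so the deformation of the contour is mere
telescoping (`exists_primitive_taylorCoeff`, `norm_taylorCoeff_le`). The uniform estimate is
`exists_norm_taylorCoeff_remainder_le`. -/

noncomputable section

namespace CycleWeights

open Finset

/-! ### Cycle types, partitions and the exponential formula -/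

/-- The number of permutations with a given full cycle type. -/
theorem card_partition_mul {α : Type*} [Fintype α] [DecidableEq α]
    (p : (Fintype.card α).Partition) :
    (univ.filter fun σ : Equiv.Perm α => σ.partition = p).card *
      (p.parts.prod * ∏ i ∈ p.parts.toFinset, (p.parts.count i).factorial) =
      (Fintype.card α).factorial := by
  -- `cycleType` omits fixed points, so it corresponds to the parts that are at least `2`; the parts
  -- equal to `1` count the fixed points.
  set m := p.parts.filter fun i => 2 ≤ i with hm
  have hsplit : p.parts = m + Multiset.replicate (p.parts.count 1) 1 := by
    conv_lhs => rw [← Multiset.filter_add_not (fun i => 2 ≤ i) p.parts]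
    congr 1
    rw [← Multiset.filter_eq' p.parts 1]
    refine Multiset.filter_congr fun i hi => ?_
    have := p.parts_pos hi
    omega
  have hsum : m.sum + p.parts.count 1 = Fintype.card α := by
    have := congrArg Multiset.sum hsplit
    rw [p.parts_sum] at this
    simpa using this.symm
  have hone : m.count 1 = 0 := by simp [hm]
  have hset : (univ.filter fun σ : Equiv.Perm α => σ.partition = p) =
      univ.filter fun σ : Equiv.Perm α => σ.cycleType = m := by
    refine Finset.filter_congr fun σ _ => ?_
    rw [Nat.Partition.ext_iff]
    constructor
    · intro h
      rw [← Equiv.Perm.filter_parts_partition_eq_cycleType, h]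
    · intro h
      rw [Equiv.Perm.parts_partition, hsplit, ← h]
      congr 2
      rw [← Equiv.Perm.sum_cycleType, h]
      omega
  have key := Equiv.Perm.card_of_cycleType_mul_eq α m
  rw [if_pos ⟨by omega, fun a ha => (Multiset.mem_filter.1 ha).2⟩] at key
  rw [hset, ← key]
  congr 1
  have hprod : p.parts.prod = m.prod := by rw [hsplit]; simp
  have hc : ∀ i, i ≠ 1 → p.parts.count i = m.count i := by
    intro i hi
    rw [hsplit, Multiset.count_add, Multiset.count_replicate, if_neg (Ne.symm hi), add_zero]
  rw [hprod, show Fintype.card α - m.sum = p.parts.count 1 by omega, mul_comm (Nat.factorial _),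
    mul_assoc]
  congr 1
  have h1 : ∏ i ∈ p.parts.toFinset, (p.parts.count i).factorial =
      ∏ i ∈ insert 1 m.toFinset, (p.parts.count i).factorial := by
    apply Finset.prod_subset
    · intro i hi
      rw [Multiset.mem_toFinset] at hi
      have := p.parts_pos hi
      simp only [mem_insert, Multiset.mem_toFinset, hm, Multiset.mem_filter]
      by_cases h : i = 1
      · exact Or.inl h
      · exact Or.inr ⟨hi, by omega⟩
    · intro i _ hi
      rw [Multiset.mem_toFinset] at hi
      simp [Multiset.count_eq_zero_of_notMem hi]
  rw [h1, Finset.prod_insert (by simp [hm])]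
  congr 1
  refine Finset.prod_congr rfl fun i hi => ?_
  rw [hc]
  rintro rfl
  simp [hm] at hi

/-- The monomial attached to a multiset of cycle lengths in the exponential formula. -/
def monomial (x : ℕ → ℝ) (s : Multiset ℕ) : ℝ :=
  ∏ i ∈ s.toFinset, x i ^ s.count i / (s.count i).factorial

theorem monomial_eq_prod (x : ℕ → ℝ) (s : Multiset ℕ) :
    monomial x s = (s.map x).prod / ∏ i ∈ s.toFinset, ((s.count i).factorial : ℝ) := by
  rw [monomial, Finset.prod_div_distrib, Finset.prod_multiset_map_count]

theorem normConst_eq_sum_partition (θ : ℕ → ℝ) (n : ℕ) (A : Finset ℕ) :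
    normConst θ n A =
      ∑ p : n.Partition, monomial (fun m => (if m ∈ A then θ m else 0) / m) p.parts := by
  -- `σ.partition` is a partition of `Fintype.card (Fin n)`, which is not syntactically `n`; a
  -- variable `N` allows the substitution.
  have key : ∀ N, (hN : Fintype.card (Fin n) = N) → (∑ σ : Equiv.Perm (Fin n), weight θ A σ) =
      N.factorial *
      ∑ p : N.Partition, monomial (fun m => (if m ∈ A then θ m else 0) / m) p.parts := by
    rintro N rfl
    rw [← Finset.sum_fiberwise (s := univ) (g := fun σ : Equiv.Perm (Fin n) => σ.partition),
      Finset.mul_sum]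
    refine Finset.sum_congr rfl fun p _ => ?_
    rw [Finset.sum_congr rfl (g := fun _ =>
      (p.parts.map fun m => if m ∈ A then θ m else 0).prod), Finset.sum_const, nsmul_eq_mul,
      ← card_partition_mul p, monomial_eq_prod]
    · have hpos : (p.parts.prod : ℝ) ≠ 0 := by
        rw [Nat.cast_ne_zero, ← Nat.pos_iff_ne_zero]
        exact Multiset.prod_pos fun i hi => p.parts_pos hi
      have hf : (∏ i ∈ p.parts.toFinset, ((p.parts.count i).factorial : ℝ)) ≠ 0 :=
        Finset.prod_ne_zero_iff.2 fun i _ => by positivity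
      have : (p.parts.map fun m => (if m ∈ A then θ m else 0) / (m : ℝ)).prod =
          (p.parts.map fun m => if m ∈ A then θ m else 0).prod / (p.parts.prod : ℝ) := by
        rw [Multiset.prod_map_div]
        simp
      rw [this]
      push_cast at hpos ⊢
      field_simp
    · intro σ hσ
      rw [weight, (Finset.mem_filter.1 hσ).2]
  rw [normConst, key n (Fintype.card_fin n)]
  field_simp

theorem monomial_cons (x : ℕ → ℝ) (s : Multiset ℕ) (a : ℕ) :
    ((s.count a + 1 : ℕ) : ℝ) * monomial x (a ::ₘ s) = x a * monomial x s := by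
  have h0 : ∀ t : Multiset ℕ, ∀ u : Finset ℕ, t.toFinset ⊆ u →
      monomial x t = ∏ i ∈ u, x i ^ t.count i / (t.count i).factorial := by
    intro t u h
    refine Finset.prod_subset h fun i _ hi => ?_
    rw [Multiset.mem_toFinset] at hi
    simp [Multiset.count_eq_zero_of_notMem hi]
  rw [h0 (a ::ₘ s) (insert a s.toFinset) (by simp), h0 s (insert a s.toFinset) (by simp),
    ← Finset.mul_prod_erase _ _ (mem_insert_self a s.toFinset),
    ← Finset.mul_prod_erase (insert a s.toFinset) (fun i => x i ^ s.count i / _)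
      (mem_insert_self a s.toFinset)]
  rw [Finset.prod_congr rfl (g := fun i => x i ^ s.count i / (s.count i).factorial)]
  · rw [Multiset.count_cons_self, Nat.factorial_succ]
    push_cast
    field_simp
    ring
  · intro i hi
    rw [Multiset.count_cons_of_ne (Finset.ne_of_mem_erase hi)]

/-- Coefficient form of `z F' = (z f') F` for `F = exp f`. Write `n` as the sum of `m * count m`
over the distinct parts `m`; deleting one copy of `m` matches the partitions of `n` containing `m`
with those of `n - m`, and `monomial_cons` tracks the weight. -/
theorem sum_partition_monomial_rec (x : ℕ → ℝ) (n : ℕ) :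
    (n : ℝ) * ∑ p : n.Partition, monomial x p.parts =
      ∑ m ∈ Icc 1 n, m * x m * ∑ q : (n - m).Partition, monomial x q.parts := by
  have h1 : (n : ℝ) * ∑ p : n.Partition, monomial x p.parts =
      ∑ m ∈ Icc 1 n, ∑ p ∈ univ.filter (fun p : n.Partition => m ∈ p.parts),
        (m * p.parts.count m : ℝ) * monomial x p.parts := by
    rw [Finset.mul_sum]
    simp_rw [Finset.sum_filter]
    rw [Finset.sum_comm]
    refine Finset.sum_congr rfl fun p _ => ?_
    have hs : (n : ℝ) = ∑ m ∈ p.parts.toFinset, (m * p.parts.count m : ℝ) := by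
      have := p.parts_sum
      rw [Finset.sum_multiset_count] at this
      conv_lhs => rw [← this]
      push_cast
      simp [mul_comm]
    rw [hs, Finset.sum_mul, ← Finset.sum_filter]
    refine Finset.sum_congr ?_ fun _ _ => rfl
    ext m
    simp only [Multiset.mem_toFinset, mem_filter, mem_Icc]
    exact ⟨fun h => ⟨⟨p.parts_pos h, Nat.Partition.le_of_mem_parts h⟩, h⟩, fun h => h.2⟩
  rw [h1]
  refine Finset.sum_congr rfl fun m hm => ?_
  obtain ⟨hm1, hm2⟩ := mem_Icc.1 hm
  rw [Finset.mul_sum]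
  refine Finset.sum_bij'
    (i := fun p hp => (⟨p.parts.erase m, fun h => p.parts_pos (Multiset.mem_of_mem_erase h), by
      have := Multiset.sum_erase (mem_filter.1 hp).2
      rw [p.parts_sum] at this
      omega⟩ : (n - m).Partition))
    (j := fun q _ => (⟨m ::ₘ q.parts, fun {i} h => by
        rcases Multiset.mem_cons.1 h with rfl | h
        · exact hm1
        · exact q.parts_pos h, by
      rw [Multiset.sum_cons, q.parts_sum]
      omega⟩ : n.Partition)) ?_ ?_ ?_ ?_ ?_
  · intro p hp; exact mem_univ _
  · intro q hq; simp
  · intro p hp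
    ext1
    exact Multiset.cons_erase (mem_filter.1 hp).2
  · intro q hq
    ext1
    simp
  · intro p hp
    have hmem := (mem_filter.1 hp).2
    have := monomial_cons x (p.parts.erase m) m
    rw [Multiset.cons_erase hmem, Multiset.count_erase_self,
      Nat.sub_add_cancel (Multiset.one_le_count_iff_mem.2 hmem)] at this
    rw [mul_assoc, this, mul_assoc]

theorem normConst_zero (θ : ℕ → ℝ) (A : Finset ℕ) : normConst θ 0 A = 1 := by
  rw [normConst_eq_sum_partition]
  simp [monomial]

/-- The recursion satisfied by the normalization constants. -/
theorem normConst_rec (θ : ℕ → ℝ) (n : ℕ) (A : Finset ℕ) :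
    (n : ℝ) * normConst θ n A =
      ∑ m ∈ Icc 1 n, (if m ∈ A then θ m else 0) * normConst θ (n - m) A := by
  simp_rw [normConst_eq_sum_partition]
  rw [sum_partition_monomial_rec]
  refine Finset.sum_congr rfl fun m hm => ?_
  have : (m : ℝ) ≠ 0 := by
    have := (mem_Icc.1 hm).1
    positivity
  congr 1
  field_simp

/-! ### Taylor coefficients of exponentials -/

/-- The `n`-th Taylor coefficient of `f` at the origin. -/
def taylorCoeff (f : ℂ → ℂ) (n : ℕ) : ℂ := iteratedDeriv n f 0 / n.factorial

theorem hasFPowerSeriesAt_of_hasSum {f : ℂ → ℂ} {c : ℕ → ℂ}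
    (h : ∀ᶠ z in 𝓝 (0 : ℂ), HasSum (fun m => c m * z ^ m) (f z)) :
    HasFPowerSeriesAt f (FormalMultilinearSeries.ofScalars ℂ c) 0 := by
  rw [hasFPowerSeriesAt_iff]
  filter_upwards [h] with z hz
  simpa [mul_comm] using hz

theorem taylorCoeff_of_hasSum {f : ℂ → ℂ} {c : ℕ → ℂ}
    (h : ∀ᶠ z in 𝓝 (0 : ℂ), HasSum (fun m => c m * z ^ m) (f z)) (n : ℕ) :
    taylorCoeff f n = c n := by
  obtain ⟨r, hr⟩ := hasFPowerSeriesAt_of_hasSum h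
  have := hr.factorial_smul 1 n
  rw [iteratedFDeriv_apply_eq_iteratedDeriv_mul_prod, Finset.prod_const_one, one_smul] at this
  rw [taylorCoeff, ← this]
  have hn : (n.factorial : ℂ) ≠ 0 := Nat.cast_ne_zero.2 n.factorial_ne_zero
  simp [hn]

theorem taylorCoeff_exp_zero (f : ℂ → ℂ) :
    taylorCoeff (fun z => Complex.exp (f z)) 0 = Complex.exp (f 0) := by
  simp [taylorCoeff]

/-- Leibniz rule applied to `(exp f)' = f' exp f`. This is the recursion of `normConst_rec`, so the
two sequences can be identified by strong induction. -/
theorem taylorCoeff_exp_succ {f : ℂ → ℂ} (hf : AnalyticAt ℂ f 0) (n : ℕ) :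
    ((n + 1 : ℕ) : ℂ) * taylorCoeff (fun z => Complex.exp (f z)) (n + 1) =
      ∑ i ∈ range (n + 1), ((i + 1 : ℕ) : ℂ) * taylorCoeff f (i + 1) *
        taylorCoeff (fun z => Complex.exp (f z)) (n - i) := by
  have hF : AnalyticAt ℂ (fun z => Complex.exp (f z)) 0 := hf.cexp
  have hd : deriv (fun z => Complex.exp (f z)) =ᶠ[𝓝 0]
      (deriv f * fun z => Complex.exp (f z)) := by
    filter_upwards [hf.eventually_analyticAt] with z hz
    rw [Pi.mul_apply, mul_comm]
    exact hz.differentiableAt.hasDerivAt.cexp.deriv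
  have h1 : iteratedDeriv (n + 1) (fun z => Complex.exp (f z)) 0 =
      ∑ i ∈ range (n + 1), (n.choose i : ℂ) * iteratedDeriv (i + 1) f 0 *
        iteratedDeriv (n - i) (fun z => Complex.exp (f z)) 0 := by
    rw [iteratedDeriv_succ', hd.iteratedDeriv_eq,
      iteratedDeriv_mul hf.deriv.contDiffAt hF.contDiffAt]
    simp_rw [iteratedDeriv_succ']
  unfold taylorCoeff
  rw [h1, Finset.sum_div, Finset.mul_sum]
  refine Finset.sum_congr rfl fun i hi => ?_
  have hi' : i ≤ n := Nat.lt_succ_iff.1 (Finset.mem_range.1 hi)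
  have hc : (n.choose i : ℂ) * i.factorial * (n - i).factorial = n.factorial := by
    exact_mod_cast Nat.choose_mul_factorial_mul_factorial hi'
  have h2 : (i.factorial : ℂ) ≠ 0 := Nat.cast_ne_zero.2 i.factorial_ne_zero
  have h3 : ((n - i).factorial : ℂ) ≠ 0 := Nat.cast_ne_zero.2 (n - i).factorial_ne_zero
  have h4 : (n.factorial : ℂ) ≠ 0 := Nat.cast_ne_zero.2 n.factorial_ne_zero
  have h5 : ((n + 1 : ℕ) : ℂ) ≠ 0 := Nat.cast_ne_zero.2 n.succ_ne_zero
  have h6 : ((i + 1 : ℕ) : ℂ) ≠ 0 := Nat.cast_ne_zero.2 i.succ_ne_zero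
  have hcc : (n.choose i : ℂ) = n.factorial / (i.factorial * (n - i).factorial) := by
    rw [eq_div_iff (mul_ne_zero h2 h3), ← hc]; ring
  rw [hcc, Nat.factorial_succ n, Nat.factorial_succ i]
  push_cast at h5 h6 ⊢
  field_simp

/-- The normalization constants are the Taylor coefficients of the exponential of a power series
whose coefficients are prescribed by `θ` and `A` up to the relevant order. -/
theorem taylorCoeff_exp_eq_normConst {f : ℂ → ℂ} {c : ℕ → ℂ} (θ : ℕ → ℝ) (A : Finset ℕ) (n : ℕ)
    (h : ∀ᶠ z in 𝓝 (0 : ℂ), HasSum (fun m => c m * z ^ m) (f z)) (h0 : c 0 = 0)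
    (hc : ∀ m, 1 ≤ m → m ≤ n → (m : ℂ) * c m = ((if m ∈ A then θ m else 0 : ℝ) : ℂ)) :
    ∀ k ≤ n, taylorCoeff (fun z => Complex.exp (f z)) k = normConst θ k A := by
  have hf : AnalyticAt ℂ f 0 := (hasFPowerSeriesAt_of_hasSum h).analyticAt
  intro k
  induction k using Nat.strong_induction_on with
  | _ k ih =>
  intro hk
  rcases k with _ | k
  · have : f 0 = 0 := by
      have := taylorCoeff_of_hasSum h 0
      simpa [taylorCoeff, h0] using this
    rw [taylorCoeff_exp_zero, this, normConst_zero]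
    simp
  · have h1 := taylorCoeff_exp_succ hf k
    have h2 := congrArg (fun x : ℝ => (x : ℂ)) (normConst_rec θ (k + 1) A)
    have h5 : ((k + 1 : ℕ) : ℂ) ≠ 0 := Nat.cast_ne_zero.2 k.succ_ne_zero
    apply mul_left_cancel₀ h5
    rw [h1]
    push_cast at h2 ⊢
    rw [h2, ← Finset.Ico_add_one_right_eq_Icc, Finset.sum_Ico_eq_sum_range]
    refine Finset.sum_congr (by simp) fun i hi => ?_
    have hi' : i ≤ k := Nat.lt_succ_iff.1 (by simpa using hi)
    rw [taylorCoeff_of_hasSum h, ih (k - i) (by omega) (by omega), add_comm 1 i,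
      ← hc (i + 1) (by omega) (by omega), Nat.add_sub_add_right]
    push_cast
    ring

/-! ### Coefficients of `(1 - z)^(-ϑ)` with an error term -/

theorem taylorCoeff_one_sub_cpow_neg (ϑ : ℝ) (n : ℕ) :
    taylorCoeff (fun z => (1 - z) ^ (-(ϑ : ℂ))) n =
      (((∏ k ∈ range n, (ϑ + k)) / n.factorial : ℝ) : ℂ) := by
  have h := (Complex.one_div_one_sub_cpow_hasFPowerSeriesOnBall_zero (ϑ : ℂ)).hasFPowerSeriesAt
  rw [hasFPowerSeriesAt_iff] at h
  have h2 : ∀ᶠ z in 𝓝 (0 : ℂ), HasSum (fun m : ℕ => Ring.choose ((ϑ : ℂ) + m - 1) m * z ^ m)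
      ((1 - z) ^ (-(ϑ : ℂ))) := by
    filter_upwards [h] with z hz
    simpa [mul_comm, Complex.cpow_neg] using hz
  rw [taylorCoeff_of_hasSum h2, Ring.choose]
  have hn : (n.factorial : ℂ) ≠ 0 := Nat.cast_ne_zero.2 n.factorial_ne_zero
  have h3 := Ring.factorial_nsmul_multichoose_eq_ascPochhammer (ϑ : ℂ) n
  rw [show (ϑ : ℂ) + n - 1 - n + 1 = ϑ by ring]
  push_cast
  rw [eq_div_iff hn, mul_comm, ← nsmul_eq_mul, h3]
  clear h h2 h3 hn
  induction n with
  | zero => simp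
  | succ n ih =>
    rw [Finset.prod_range_succ, ← ih, ascPochhammer_succ_right, Polynomial.smeval_mul]
    simp [Polynomial.smeval_natCast]

theorem abs_log_one_add_sub_le {x : ℝ} (hx : 0 ≤ x) : |Real.log (1 + x) - x| ≤ x ^ 2 := by
  have h1 := Real.log_le_sub_one_of_pos (show 0 < 1 + x by linarith)
  have h2 := Real.one_sub_inv_le_log_of_pos (show 0 < 1 + x by linarith)
  have h3 : x - x ^ 2 ≤ 1 - (1 + x)⁻¹ := by
    rw [← sub_nonneg]
    have : 1 - (1 + x)⁻¹ - (x - x ^ 2) = x ^ 3 / (1 + x) := by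
      field_simp
      ring
    rw [this]
    positivity
  rw [abs_le]
  constructor <;> nlinarith [sq_nonneg x]

/-- A sequence whose increments are `O(n⁻²)` converges at rate `O(n⁻¹)`. -/
theorem abs_sub_le_of_increment_le {v : ℕ → ℝ} {l C : ℝ} (hC : 0 ≤ C)
    (hv : ∀ n : ℕ, 1 ≤ n → |v (n + 1) - v n| ≤ C / (n : ℝ) ^ 2) (hl : Tendsto v atTop (𝓝 l))
    {n : ℕ} (hn : 1 ≤ n) : |v n - l| ≤ 2 * C / n := by
  have hn0 : (0 : ℝ) < n := by positivity
  have key : ∀ k : ℕ, |v n - v (n + k)| ≤ 2 * C * (1 / (n : ℝ) - 1 / ((n + k : ℕ) : ℝ)) := by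
    intro k
    induction k with
    | zero => simp
    | succ k ih =>
      have hk0 : (1 : ℝ) ≤ ((n + k : ℕ) : ℝ) := by exact_mod_cast (by omega : 1 ≤ n + k)
      have h1 := hv (n + k) (by omega)
      -- Telescoping majorant for the increments: `1/x^2 ≤ 2 (1/x - 1/(x+1))` because `x ≥ 1`.
      have h2 : C / ((n + k : ℕ) : ℝ) ^ 2 ≤
          2 * C * (1 / ((n + k : ℕ) : ℝ) - 1 / ((n + (k + 1) : ℕ) : ℝ)) := by
        rw [← add_assoc, Nat.cast_add_one (n + k)]
        set x : ℝ := ((n + k : ℕ) : ℝ)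
        have : 2 * C * (1 / x - 1 / (x + 1)) - C / x ^ 2 = C * (x - 1) / (x ^ 2 * (x + 1)) := by
          field_simp
          ring
        have h3 : 0 ≤ C * (x - 1) / (x ^ 2 * (x + 1)) := by
          apply div_nonneg (mul_nonneg hC (by linarith)); positivity
        linarith
      have h3 : |v n - v (n + (k + 1))| ≤ |v n - v (n + k)| + |v (n + k + 1) - v (n + k)| := by
        rw [abs_sub_comm (v (n + k + 1))]
        exact abs_sub_le _ _ _
      linarith
  have hlim : Tendsto (fun k => |v n - v (n + k)|) atTop (𝓝 |v n - l|) :=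
    ((tendsto_const_nhds).sub (hl.comp (tendsto_add_atTop_nat n |>.congr fun k => by ring))).abs
  refine le_of_tendsto hlim (Eventually.of_forall fun k => (key k).trans ?_)
  have h4 : (0 : ℝ) ≤ 1 / ((n + k : ℕ) : ℝ) := by positivity
  rw [div_eq_mul_one_div (2 * C)]
  exact mul_le_mul_of_nonneg_left (by linarith) (by linarith)

/-- The asymptotics of the Taylor coefficients of `(1 - z) ^ (-ϑ)`, with error term. -/
theorem exists_taylorCoeff_one_sub_cpow_neg_bound {ϑ : ℝ} (hϑ : 0 < ϑ) :
    ∃ C : ℝ, 0 ≤ C ∧ ∀ n : ℕ, 1 ≤ n →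
      ‖taylorCoeff (fun z => (1 - z) ^ (-(ϑ : ℂ))) n -
        (((n : ℝ) ^ (ϑ - 1) / Real.Gamma ϑ : ℝ) : ℂ)‖ ≤ C * (n : ℝ) ^ (ϑ - 2) := by
  set b : ℕ → ℝ := fun n => (∏ k ∈ range n, (ϑ + k)) / n.factorial with hb
  have hbpos : ∀ n, 0 < b n := fun n =>
    div_pos (Finset.prod_pos fun k _ => by positivity) (by positivity)
  have hG := Real.Gamma_pos_of_pos hϑ
  set u : ℕ → ℝ := fun n => b n * (n : ℝ) ^ (1 - ϑ) with hu
  have hupos : ∀ n, 1 ≤ n → 0 < u n := fun n hn => by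
    have : (0 : ℝ) < n := by positivity
    exact mul_pos (hbpos n) (by positivity)
  have hulim : Tendsto u atTop (𝓝 (Real.Gamma ϑ)⁻¹) := by
    have h1 := (Real.GammaSeq_tendsto_Gamma ϑ).inv₀ hG.ne'
    -- The product in `GammaSeq` has one factor more, `ϑ + n`, which this quotient compensates.
    have h2 : Tendsto (fun n : ℕ => (n : ℝ) / (n + ϑ)) atTop (𝓝 1) :=
      tendsto_natCast_div_add_atTop ϑ
    have h3 := h2.mul h1
    rw [one_mul] at h3
    refine h3.congr' ?_
    filter_upwards [eventually_ge_atTop 1] with n hn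
    have hn0 : (0 : ℝ) < n := by positivity
    have hp : 0 < ∏ k ∈ range n, (ϑ + (k : ℝ)) := Finset.prod_pos fun k _ => by positivity
    simp only [hu, hb, Real.GammaSeq]
    rw [Finset.prod_range_succ, Real.rpow_sub hn0, Real.rpow_one]
    have : (0 : ℝ) < (n : ℝ) ^ ϑ := by positivity
    field_simp
    ring
  have hvlim : Tendsto (fun n => Real.log (u n)) atTop (𝓝 (Real.log (Real.Gamma ϑ)⁻¹)) :=
    hulim.log (inv_pos.2 hG).ne'
  have hinc : ∀ n : ℕ, 1 ≤ n →
      |Real.log (u (n + 1)) - Real.log (u n)| ≤ (ϑ ^ 2 + ϑ) / (n : ℝ) ^ 2 := by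
    intro n hn
    have hn0 : (0 : ℝ) < n := by positivity
    have hbs : b (n + 1) = b n * ((ϑ + n) / (n + 1)) := by
      simp only [hb]
      rw [Finset.prod_range_succ, Nat.factorial_succ]
      push_cast
      field_simp
    -- In this form the first-order terms `ϑ / n` of the two logarithms cancel, so the increment is
    -- `O(n⁻²)`.
    have e1 : Real.log (u (n + 1)) - Real.log (u n) =
        (Real.log (1 + ϑ / n) - ϑ / n) - ϑ * (Real.log (1 + 1 / n) - 1 / n) := by
      simp only [hu]
      have p1 : Real.log (1 + ϑ / n) = Real.log (ϑ + n) - Real.log n := by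
        rw [← Real.log_div (by positivity) (by positivity)]
        congr 1
        field_simp
        ring
      have p2 : Real.log (1 + 1 / n) = Real.log (n + 1) - Real.log n := by
        rw [← Real.log_div (by positivity) (by positivity)]
        congr 1
        field_simp
      have p3 : ((n + 1 : ℕ) : ℝ) = n + 1 := by push_cast; ring
      rw [hbs, p1, p2, p3, Real.log_mul (by have := hbpos n; positivity) (by positivity),
        Real.log_mul (hbpos n).ne' (by positivity), Real.log_mul (hbpos n).ne' (by positivity),
        Real.log_rpow (by positivity), Real.log_rpow hn0,
        Real.log_div (x := ϑ + n) (y := n + 1) (by positivity) (by positivity)]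
      field_simp
      ring
    rw [e1]
    have q1 := abs_log_one_add_sub_le (show 0 ≤ ϑ / n by positivity)
    have q2 := abs_log_one_add_sub_le (show (0 : ℝ) ≤ 1 / n by positivity)
    calc _ ≤ |Real.log (1 + ϑ / n) - ϑ / n| + |ϑ * (Real.log (1 + 1 / n) - 1 / n)| := abs_sub _ _
      _ = |Real.log (1 + ϑ / n) - ϑ / n| + ϑ * |Real.log (1 + 1 / n) - 1 / n| := by
        rw [abs_mul, abs_of_pos hϑ]
      _ ≤ (ϑ / n) ^ 2 + ϑ * (1 / n) ^ 2 := by gcongr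
      _ = _ := by field_simp
  set M : ℝ := 2 * (ϑ ^ 2 + ϑ) with hM
  have hM0 : 0 ≤ M := by positivity
  refine ⟨(Real.Gamma ϑ)⁻¹ * (M * Real.exp M), by positivity, fun n hn => ?_⟩
  have hn0 : (0 : ℝ) < n := by positivity
  have hn1 : (1 : ℝ) ≤ n := by exact_mod_cast hn
  have hd := abs_sub_le_of_increment_le (by positivity) hinc hvlim hn
  rw [← hM] at hd
  set δ : ℝ := Real.log (u n) - Real.log (Real.Gamma ϑ)⁻¹ with hδ
  have hδM : |δ| ≤ M := hd.trans (div_le_self hM0 hn1)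
  have hue : u n = (Real.Gamma ϑ)⁻¹ * Real.exp δ := by
    rw [hδ, Real.exp_sub, Real.exp_log (hupos n hn), Real.exp_log (inv_pos.2 hG)]
    field_simp
  have hexp : |Real.exp δ - 1| ≤ M / n * Real.exp M := by
    have h1 := Complex.norm_exp_sub_sum_le_norm_mul_exp (δ : ℂ) 1
    simp only [Finset.sum_range_one, pow_zero, Nat.factorial_zero, Nat.cast_one, div_one,
      pow_one] at h1
    rw [← Complex.ofReal_exp, ← Complex.ofReal_one, ← Complex.ofReal_sub, Complex.norm_real,
      Complex.norm_real, Real.norm_eq_abs, Real.norm_eq_abs] at h1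
    refine h1.trans ?_
    gcongr
  have hbn : b n = u n * (n : ℝ) ^ (ϑ - 1) := by
    simp only [hu]
    rw [mul_assoc, ← Real.rpow_add hn0]
    simp
  rw [taylorCoeff_one_sub_cpow_neg, ← Complex.ofReal_sub, Complex.norm_real, Real.norm_eq_abs]
  change |b n - _| ≤ _
  rw [hbn, hue, show (Real.Gamma ϑ)⁻¹ * Real.exp δ * (n : ℝ) ^ (ϑ - 1) -
    (n : ℝ) ^ (ϑ - 1) / Real.Gamma ϑ = (Real.Gamma ϑ)⁻¹ * (n : ℝ) ^ (ϑ - 1) * (Real.exp δ - 1) by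
    field_simp, abs_mul, abs_of_pos (by positivity)]
  calc _ ≤ (Real.Gamma ϑ)⁻¹ * (n : ℝ) ^ (ϑ - 1) * (M / n * Real.exp M) := by gcongr
    _ = _ := by
      rw [show ϑ - 2 = ϑ - 1 - 1 by ring, Real.rpow_sub_one hn0.ne' (ϑ - 1)]
      field_simp

/-! ### Geometry of `Δ₀` and of its logarithmic image -/

/-- Up to the factor `‖u‖` the hypothesis says `sin (φ - |arg u|) < 0`. It turns the condition on
the argument into an inequality between real and imaginary parts. -/
theorem lt_abs_arg_of_sin_mul_re_lt {φ : ℝ} (h0 : 0 < φ) (h1 : φ < Real.pi / 2) {u : ℂ}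
    (h : Real.sin φ * u.re < Real.cos φ * |u.im|) : φ < |Complex.arg u| := by
  by_contra! hle
  have hs : 0 ≤ Real.sin (φ - |Complex.arg u|) := by
    apply Real.sin_nonneg_of_nonneg_of_le_pi
    · linarith
    · linarith [abs_nonneg (Complex.arg u), Real.pi_pos]
  have habs : |Real.sin (Complex.arg u)| = Real.sin |Complex.arg u| := by
    rw [Real.abs_sin_eq_sin_abs_of_abs_le_pi (Complex.abs_arg_le_pi u)]
  rw [Real.sin_sub, Real.cos_abs, ← habs] at hs
  have hre := Complex.norm_mul_cos_arg u
  have him := Complex.norm_mul_sin_arg u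
  rw [← hre, ← him, abs_mul, abs_norm] at h
  nlinarith [mul_nonneg (norm_nonneg u) hs]

theorem mem_Delta0_of_sin_mul_re_lt {r R φ : ℝ} (h0 : 0 < φ) (h1 : φ < Real.pi / 2) {z : ℂ}
    (hz : ‖z‖ < R) (h : Real.sin φ * (z - r).re < Real.cos φ * |(z - r).im|) :
    z ∈ Delta0 r R φ := by
  refine ⟨hz, ?_, lt_abs_arg_of_sin_mul_re_lt h0 h1 h⟩
  rintro rfl
  simp at h

theorem ball_subset_Delta0 {r R φ : ℝ} (hR : r < R) (h0 : 0 < φ) (h1 : φ < Real.pi / 2) :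
    Metric.ball 0 r ⊆ Delta0 r R φ := by
  intro z hz
  rw [mem_ball_zero_iff] at hz
  have hre := (Complex.re_le_norm z).trans_lt hz
  refine mem_Delta0_of_sin_mul_re_lt h0 h1 (hz.trans hR) ?_
  have hs := Real.sin_pos_of_pos_of_lt_pi h0 (by linarith [Real.pi_pos])
  have hc := Real.cos_pos_of_mem_Ioo ⟨by linarith, h1⟩
  have : Real.sin φ * (z - r).re < 0 := mul_neg_of_pos_of_neg hs (by simp; linarith)
  have : 0 ≤ Real.cos φ * |(z - r).im| := by positivity
  linarith

/-- The disc whose boundary passes through `0` and `2πi`. -/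
def logDisc (c : ℝ) : Set ℂ :=
  Metric.ball (-(c : ℂ) + Real.pi * Complex.I) (Real.sqrt (c ^ 2 + Real.pi ^ 2))

theorem mem_logDisc {c : ℝ} {w : ℂ} :
    w ∈ logDisc c ↔ w.re ^ 2 + 2 * c * w.re < w.im * (2 * Real.pi - w.im) := by
  rw [logDisc, mem_ball_iff_norm, Complex.norm_eq_sqrt_sq_add_sq,
    Real.sqrt_lt_sqrt_iff (by positivity)]
  simp
  constructor <;> intro h <;> nlinarith

theorem mul_le_sin {u : ℝ} (h0 : 0 ≤ u) (h1 : u ≤ Real.pi) :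
    2 / Real.pi ^ 2 * (u * (Real.pi - u)) ≤ Real.sin u := by
  have hpi := Real.pi_pos
  wlog h : u ≤ Real.pi / 2 generalizing u
  · have := this (u := Real.pi - u) (by linarith) (by linarith) (by linarith)
    rw [Real.sin_pi_sub] at this
    linarith
  refine le_trans ?_ (Real.mul_le_sin h0 h)
  rw [show 2 / Real.pi ^ 2 * (u * (Real.pi - u)) = 2 / Real.pi * u * ((Real.pi - u) / Real.pi) by
    field_simp]
  apply mul_le_of_le_one_right (by positivity)
  rw [div_le_one hpi]
  linarith

/-- The exponential maps a suitable disc touching `0` and `2πi` into a given `Δ₀`. -/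
theorem exists_exp_mem_Delta0 {R φ : ℝ} (hR : 1 < R) (h0 : 0 < φ) (h1 : φ < Real.pi / 2) :
    ∃ c : ℝ, 1 ≤ c ∧ ∀ w ∈ logDisc c, Complex.exp w ∈ Delta0 1 R φ := by
  have hpi := Real.pi_pos
  have hs := Real.sin_pos_of_pos_of_lt_pi h0 (by linarith [Real.pi_pos])
  have hc := Real.cos_pos_of_mem_Ioo (x := φ) ⟨by linarith, h1⟩
  have hlog := Real.log_pos hR
  set m := min (Real.sin φ) (Real.cos φ) with hm
  have hm0 : 0 < m := lt_min hs hc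
  -- A large `c` flattens the right-hand arc of the disc. The term with `log R` keeps `|e^w| < R`;
  -- the term with `m` makes the arc steep enough at `0` and `2πi` to stay outside the sector of
  -- angle `φ`.
  refine ⟨1 + Real.pi ^ 2 / (2 * Real.log R) + Real.pi ^ 2 / (2 * m), ?_, fun w hw => ?_⟩
  · have : 0 ≤ Real.pi ^ 2 / (2 * Real.log R) + Real.pi ^ 2 / (2 * m) := by positivity
    linarith
  set c := 1 + Real.pi ^ 2 / (2 * Real.log R) + Real.pi ^ 2 / (2 * m) with hcdef
  have hcR : Real.pi ^ 2 ≤ 2 * c * Real.log R := by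
    have : Real.pi ^ 2 / (2 * Real.log R) ≤ c := by
      have : 0 ≤ Real.pi ^ 2 / (2 * m) := by positivity
      linarith
    rw [div_le_iff₀ (by positivity)] at this
    linarith
  have hcm : Real.pi ^ 2 ≤ 2 * c * m := by
    have : Real.pi ^ 2 / (2 * m) ≤ c := by
      have : 0 ≤ Real.pi ^ 2 / (2 * Real.log R) := by positivity
      linarith
    rw [div_le_iff₀ (by positivity)] at this
    linarith
  have hc0 : 0 < c := by positivity
  rw [mem_logDisc] at hw
  set x := w.re
  set y := w.im
  have hxR : x < Real.log R := by
    have : 2 * c * x < 2 * c * Real.log R := by nlinarith [sq_nonneg (y - Real.pi), sq_nonneg x]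
    exact lt_of_mul_lt_mul_left this (by positivity)
  have hnorm : ‖Complex.exp w‖ < R := by
    rw [Complex.norm_exp, ← Real.lt_log_iff_exp_lt (by linarith)]
    exact hxR
  refine mem_Delta0_of_sin_mul_re_lt h0 h1 hnorm ?_
  simp only [Complex.ofReal_one, Complex.sub_re, Complex.exp_re, Complex.one_re, Complex.sub_im,
    Complex.exp_im, Complex.one_im, sub_zero]
  change Real.sin φ * (Real.exp x * Real.cos y - 1) < Real.cos φ * |Real.exp x * Real.sin y|
  have hex := Real.exp_pos x
  rcases lt_or_ge x 0 with hx | hx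
  · have h3 : Real.exp x * Real.cos y < 1 := by
      have := Real.exp_lt_one_iff.2 hx
      nlinarith [Real.cos_le_one y]
    have : 0 ≤ Real.cos φ * |Real.exp x * Real.sin y| := by positivity
    nlinarith
  · have hy : 0 < y * (2 * Real.pi - y) := lt_of_le_of_lt (by positivity) hw
    have hy0 : 0 < y ∧ y < 2 * Real.pi := by
      rcases pos_and_pos_or_neg_and_neg_of_mul_pos hy with h | h
      · exact ⟨h.1, by linarith⟩
      · linarith
    -- With the half-angle `u` and after division by `e^x`, the goal reads `sin φ (1 - e^{-x}) < 2
    -- sin u (sin φ sin u + cos φ |cos u|)`. The bracket is at least `m`, and `x < 2 m sin u` in the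
    -- disc.
    obtain ⟨u, hu⟩ : ∃ u, y = 2 * u := ⟨y / 2, by ring⟩
    rw [hu] at hw hy0
    have hu0 : 0 < u := by linarith
    have hu1 : u < Real.pi := by linarith
    have hsu := Real.sin_pos_of_pos_of_lt_pi hu0 hu1
    have hx2 : 1 - Real.exp (-x) ≤ x := by linarith [Real.add_one_le_exp (-x)]
    have hcx : c * x < 2 * (u * (Real.pi - u)) := by nlinarith [sq_nonneg x]
    have hsin := mul_le_sin hu0.le hu1.le
    rw [div_mul_eq_mul_div, div_le_iff₀ (by positivity)] at hsin
    have hxm : x < 2 * m * Real.sin u := by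
      have h4 : c * x < c * (2 * m * Real.sin u) := by
        calc c * x < Real.sin u * Real.pi ^ 2 := by linarith
          _ ≤ Real.sin u * (2 * c * m) := by gcongr
          _ = _ := by ring
      exact lt_of_mul_lt_mul_left h4 hc0.le
    have hsc : 1 ≤ Real.sin u + |Real.cos u| := by
      have h5 := Real.sin_sq_add_cos_sq u
      rw [← sq_abs (Real.cos u)] at h5
      nlinarith [abs_nonneg (Real.cos u)]
    have h6 : m ≤ Real.sin φ * Real.sin u + Real.cos φ * |Real.cos u| := by
      have h7 : m * Real.sin u ≤ Real.sin φ * Real.sin u := by gcongr; exact min_le_left _ _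
      have h8 : m * |Real.cos u| ≤ Real.cos φ * |Real.cos u| := by gcongr; exact min_le_right _ _
      nlinarith
    have h9 : 1 - Real.exp (-x) <
        2 * Real.sin u * (Real.sin φ * Real.sin u + Real.cos φ * |Real.cos u|) := by
      calc 1 - Real.exp (-x) < 2 * Real.sin u * m := by linarith
        _ ≤ _ := by gcongr
    have h10 : Real.sin φ * (1 - Real.exp (-x)) <
        2 * Real.sin u * (Real.sin φ * Real.sin u + Real.cos φ * |Real.cos u|) := by
      have : 0 ≤ 1 - Real.exp (-x) := by
        have := Real.exp_le_one_iff.2 (show -x ≤ 0 by linarith)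
        linarith
      nlinarith [Real.sin_le_one φ]
    have h11 := mul_lt_mul_of_pos_left h10 hex
    have h12 : Real.exp x * Real.exp (-x) = 1 := by rw [← Real.exp_add]; simp
    rw [hu, Real.cos_two_mul, Real.sin_two_mul, abs_mul, abs_mul, abs_mul, abs_of_pos hex,
      abs_of_pos hsu, abs_of_pos (show (0 : ℝ) < 2 by norm_num)]
    have h13 := Real.sin_sq_add_cos_sq u
    have h14 : Real.cos u ^ 2 = 1 - Real.sin u ^ 2 := by linarith
    rw [h14]
    have h15 : Real.exp x * (Real.sin φ * (1 - Real.exp (-x))) =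
      Real.sin φ * (Real.exp x - 1) := by
      rw [show Real.exp x * (Real.sin φ * (1 - Real.exp (-x))) =
        Real.sin φ * (Real.exp x - Real.exp x * Real.exp (-x)) by ring, h12]
    rw [h15] at h11
    linarith

/-! ### Contour integrals in the logarithmic plane -/

/-- Taylor coefficients as increments of a primitive in the logarithmic plane. -/
theorem exists_primitive_taylorCoeff {R φ c : ℝ} {W : ℂ → ℂ} (hR : 1 < R) (h0 : 0 < φ)
    (h1 : φ < Real.pi / 2) (hW : DifferentiableOn ℂ W (Delta0 1 R φ)) (hc : 1 ≤ c)
    (hexp : ∀ w ∈ logDisc c, Complex.exp w ∈ Delta0 1 R φ) {n : ℕ} (hn : 1 ≤ n) :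
    ∃ H : ℂ → ℂ, (∀ w ∈ logDisc c,
        HasDerivAt H (W (Complex.exp w) * Complex.exp (-(n * w))) w) ∧
      H (-(1 / n : ℝ) + 2 * Real.pi * Complex.I) - H (-(1 / n : ℝ)) =
        2 * Real.pi * Complex.I * taylorCoeff W n := by
  have hn0 : (0 : ℝ) < n := by positivity
  have hn1 : (1 / n : ℝ) ≤ 1 := by
    rw [div_le_one hn0]; exact_mod_cast hn
  have hd : DifferentiableOn ℂ (fun w => W (Complex.exp w) * Complex.exp (-(n * w)))
      (logDisc c) :=
    (hW.comp Complex.differentiable_exp.differentiableOn hexp).mul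
      (by fun_prop)
  obtain ⟨H, hH⟩ := hd.isExactOn_ball
  refine ⟨H, hH, ?_⟩
  -- The circle of radius `e^{-1/n}` lifts to the vertical segment from `-1/n` to `-1/n + 2πi`, and
  -- `dz / z^(n+1)` becomes `e^{-nw} dw`. On it `|z^{-n}| = e`.
  set ρ : ℝ := Real.exp (-(1 / n : ℝ)) with hρ
  have hρ1 : ρ < 1 := Real.exp_lt_one_iff.2 (by simp; omega)
  have hcirc := DifferentiableOn.circleIntegral_one_div_sub_center_pow_smul (R := ρ) (c := 0)
    (f := W) (Real.exp_pos _) n (hW.mono ((Metric.closedBall_subset_ball hρ1).trans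
      (ball_subset_Delta0 hR h0 h1)))
  have hmem : ∀ t ∈ Set.uIcc 0 (2 * Real.pi),
      (-(1 / n : ℝ) + t * Complex.I : ℂ) ∈ logDisc c := by
    intro t ht
    rw [Set.uIcc_of_le (by positivity)] at ht
    rw [mem_logDisc]
    have e1 : (-(1 / n : ℝ) + t * Complex.I : ℂ).re = -(1 / n : ℝ) := by
      simp [-one_div]
    have e2 : (-(1 / n : ℝ) + t * Complex.I : ℂ).im = t := by
      simp [-one_div]
    rw [e1, e2]
    have h3 : 0 ≤ t * (2 * Real.pi - t) := mul_nonneg ht.1 (by linarith [ht.2])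
    have h4 : (0 : ℝ) < 1 / n := by positivity
    nlinarith
  have hFTC := intervalIntegral.integral_eq_sub_of_hasDerivAt (a := 0) (b := 2 * Real.pi)
    (f := fun t : ℝ => H (-(1 / n : ℝ) + t * Complex.I))
    (f' := fun t : ℝ => W (Complex.exp (-(1 / n : ℝ) + t * Complex.I)) *
      Complex.exp (-(n * (-(1 / n : ℝ) + t * Complex.I))) * Complex.I) ?_ ?_
  · rw [smul_eq_mul] at hcirc
    rw [taylorCoeff, ← mul_div_assoc, mul_div_right_comm, ← hcirc]
    rw [Complex.ofReal_zero, zero_mul, add_zero, Complex.ofReal_mul, Complex.ofReal_ofNat] at hFTC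
    rw [← hFTC, circleIntegral]
    refine intervalIntegral.integral_congr fun t _ => ?_
    have hcm : circleMap 0 ρ t = Complex.exp (-(1 / n : ℝ) + t * Complex.I) := by
      rw [circleMap, zero_add, hρ, Complex.ofReal_exp, ← Complex.exp_add, Complex.ofReal_neg]
    simp only [deriv_circleMap, smul_eq_mul, sub_zero, hcm]
    rw [pow_succ, ← Complex.exp_nat_mul, Complex.exp_neg]
    have := Complex.exp_ne_zero (-(1 / n : ℝ) + t * Complex.I)
    field_simp
  · intro t ht
    have hcomp : HasDerivAt (fun t : ℝ => (-(1 / n : ℝ) + t * Complex.I : ℂ)) Complex.I t := by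
      have := ((Complex.ofRealCLM.hasDerivAt (x := t)).mul_const Complex.I).const_add
        (-(1 / n : ℝ) : ℂ)
      simpa using this
    exact (hH _ (hmem t ht)).comp_of_eq t hcomp rfl
  · refine ContinuousOn.intervalIntegrable ?_
    refine ContinuousOn.mul ?_ continuousOn_const
    exact hd.continuousOn.comp (by fun_prop) hmem

/-- The bound is the integral of `M e^{-as}` over the half-line. Comparison with its explicit
primitive avoids any integrability assumption on `f'`. -/
theorem norm_sub_le_of_norm_deriv_le_exp {f f' : ℝ → ℂ} {T M a : ℝ} (hT : 0 ≤ T) (hM : 0 ≤ M)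
    (ha : 0 < a) (hf : ∀ s ∈ Set.Icc 0 T, HasDerivAt f (f' s) s)
    (hb : ∀ s ∈ Set.Icc 0 T, ‖f' s‖ ≤ M * Real.exp (-(a * s))) : ‖f T - f 0‖ ≤ M / a := by
  have hB : ∀ s, HasDerivAt (fun s => M / a - M / a * Real.exp (-(a * s)))
      (M * Real.exp (-(a * s))) s := by
    intro s
    have h : HasDerivAt (fun s => M / a - M / a * Real.exp (-(a * s)))
        (-(M / a * (Real.exp (-(a * s)) * -(a * 1)))) s :=
      ((((hasDerivAt_id s).const_mul a).neg).exp.const_mul (M / a)).const_sub (M / a)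
    refine h.congr_deriv ?_
    field_simp
  have key := image_norm_le_of_norm_deriv_right_le_deriv_boundary (a := 0) (b := T)
    (f := fun s => f s - f 0) (f' := f') (B := fun s => M / a - M / a * Real.exp (-(a * s)))
    (B' := fun s => M * Real.exp (-(a * s)))
    (fun s hs => ((hf s hs).continuousAt.continuousWithinAt).sub continuousWithinAt_const)
    (fun s hs => ((hf s (Set.Ico_subset_Icc_self hs)).sub_const _).hasDerivWithinAt)
    (by simp) hB (fun s hs => hb s (Set.Ico_subset_Icc_self hs)) (Set.right_mem_Icc.2 hT)
  refine key.trans ?_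
  have : 0 ≤ M / a * Real.exp (-(a * T)) := by positivity
  linarith

/-- The slope `1/c` makes `2c · re w = 2s - 2cX`; since `s ≤ 1` and `π > 3`, the quantity `s (2π -
s)` dominates the rest. -/
theorem mem_logDisc_of_re_eq {c s X : ℝ} {w : ℂ} (hc : 1 ≤ c) (hs0 : 0 ≤ s) (hs1 : s ≤ 1)
    (hX : 0 < X) (hX1 : X ≤ 1) (hre : w.re = s / c - X) (him1 : s ≤ w.im)
    (him2 : w.im ≤ 2 * Real.pi - s) : w ∈ logDisc c := by
  have hpi := Real.pi_gt_three
  have hc0 : 0 < c := by linarith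
  rw [mem_logDisc, hre]
  have h3 : s * (2 * Real.pi - s) ≤ w.im * (2 * Real.pi - w.im) := by nlinarith
  have h4 : (s / c) ^ 2 ≤ s := by
    have h5 : s / c ≤ s := div_le_self hs0 hc
    have h6 : 0 ≤ s / c := by positivity
    nlinarith
  have h7 : 2 * c * (s / c - X) = 2 * s - 2 * c * X := by field_simp
  have h8 : 0 ≤ s / c := by positivity
  rw [h7]
  nlinarith [mul_nonneg h8 hX.le, mul_nonneg hs0 (sub_nonneg.2 hs1), mul_pos hX hc0]

/-- Bound for Taylor coefficients from bounds on a contour made of two slanted segments starting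
near the singularity and a vertical segment, in the logarithmic plane. -/
theorem norm_taylorCoeff_le {R φ c : ℝ} {W : ℂ → ℂ} (hR : 1 < R) (h0 : 0 < φ)
    (h1 : φ < Real.pi / 2) (hW : DifferentiableOn ℂ W (Delta0 1 R φ)) (hc : 1 ≤ c)
    (hexp : ∀ w ∈ logDisc c, Complex.exp w ∈ Delta0 1 R φ) {n : ℕ} (hn : 1 ≤ n)
    {b M₁ M₂ : ℝ} (hb0 : 0 ≤ b) (hb1 : b ≤ 1) (hM₁ : 0 ≤ M₁) (hM₂ : 0 ≤ M₂)
    (hs : ∀ s ∈ Set.Icc 0 b, ∀ w : ℂ, w.re = s / c - 1 / n →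
      (w.im = s ∨ w.im = 2 * Real.pi - s) →
      ‖W (Complex.exp w)‖ ≤ M₁ * Real.exp (n * s / (2 * c)))
    (hv : ∀ w : ℂ, w.re = b / c - 1 / n → b ≤ w.im → w.im ≤ 2 * Real.pi - b →
      ‖W (Complex.exp w)‖ ≤ M₂) :
    ‖taylorCoeff W n‖ ≤
      8 * Real.exp 1 * c * (M₁ / n) + Real.exp 1 * M₂ * Real.exp (-(n * b / c)) := by
  obtain ⟨H, hH, hHn⟩ := exists_primitive_taylorCoeff hR h0 h1 hW hc hexp hn
  have hpi := Real.pi_gt_three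
  have hn0 : (0 : ℝ) < n := by positivity
  have hn1 : (1 / n : ℝ) ≤ 1 := by
    rw [div_le_one hn0]; exact_mod_cast hn
  have hn2 : (0 : ℝ) < 1 / n := by positivity
  have hc0 : 0 < c := by linarith
  have hc1 : 1 / c ≤ 1 := by rw [div_le_one hc0]; exact hc
  have hreg : ∀ s, 0 ≤ s → s ≤ b → ∀ w : ℂ, w.re = s / c - 1 / n → s ≤ w.im →
      w.im ≤ 2 * Real.pi - s → w ∈ logDisc c := fun s hs0 hsb w hre =>
    mem_logDisc_of_re_eq hc hs0 (hsb.trans hb1) hn2 hn1 hre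
  have hGnorm : ∀ w : ℂ, ∀ s, w.re = s / c - 1 / n →
      ‖Complex.exp (-(n * w))‖ = Real.exp 1 * Real.exp (-(n * s / c)) := by
    intro w s hre
    rw [Complex.norm_exp, ← Real.exp_add]
    congr 1
    simp [-one_div, hre]
    field_simp
    ring
  -- the slanted segments
  have hslant : ∀ (w₀ v : ℂ), w₀.re = -(1 / n) → v.re = 1 / c → ‖v‖ ≤ 2 →
      (w₀.im = 0 ∧ v.im = 1 ∨ w₀.im = 2 * Real.pi ∧ v.im = -1) →
      ‖H (w₀ + b * v) - H w₀‖ ≤ 4 * Real.exp 1 * c * (M₁ / n) := by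
    intro w₀ v hw₀ hv₀ hv2 him
    have hre : ∀ s : ℝ, (w₀ + s * v).re = s / c - 1 / n := by
      intro s
      simp [-one_div, hw₀, hv₀]
      ring
    have him' : ∀ s : ℝ, (w₀ + s * v).im = s ∨ (w₀ + s * v).im = 2 * Real.pi - s := by
      intro s
      rcases him with ⟨h2, h3⟩ | ⟨h2, h3⟩
      · left; simp [h2, h3]
      · right; simp [h2, h3]; ring
    -- Half of the decay `e^{-ns/c}` pays for the growth `e^{ns/(2c)}` allowed in the hypothesis on
    -- `W`; the other half gives the rate `n / (2c)`. The factor `2` in `M` bounds `‖v‖`.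
    have := norm_sub_le_of_norm_deriv_le_exp (f := fun s : ℝ => H (w₀ + s * v))
      (f' := fun s : ℝ => W (Complex.exp (w₀ + s * v)) * Complex.exp (-(n * (w₀ + s * v))) * v)
      (T := b) (M := 2 * Real.exp 1 * M₁) (a := n / (2 * c)) hb0 (by positivity) (by positivity)
      ?_ ?_
    · simp only [Complex.ofReal_zero, zero_mul, add_zero] at this
      refine this.trans (le_of_eq ?_)
      field_simp
      ring
    · intro s hs'
      have hcomp : HasDerivAt (fun t : ℝ => (w₀ + t * v : ℂ)) v s := by
        have := ((Complex.ofRealCLM.hasDerivAt (x := s)).mul_const v).const_add w₀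
        simpa using this
      refine (hH _ (hreg s hs'.1 hs'.2 _ (hre s) ?_ ?_)).comp_of_eq s hcomp rfl
      · rcases him' s with h | h <;> linarith [hs'.1, hs'.2]
      · rcases him' s with h | h <;> linarith [hs'.1, hs'.2]
    · intro s hs'
      rw [norm_mul, norm_mul, hGnorm _ s (hre s)]
      have h2 := hs s hs' _ (hre s) (him' s)
      calc _ ≤ M₁ * Real.exp (n * s / (2 * c)) * (Real.exp 1 * Real.exp (-(n * s / c))) * 2 := by
            gcongr
        _ = 2 * Real.exp 1 * M₁ * (Real.exp (n * s / (2 * c)) * Real.exp (-(n * s / c))) := by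
            ring
        _ = _ := by
            rw [← Real.exp_add]
            congr 2
            field_simp
            ring
  have hv1 : ‖(⟨1 / c, 1⟩ : ℂ)‖ ≤ 2 := by
    refine (Complex.norm_le_abs_re_add_abs_im _).trans ?_
    rw [abs_of_pos (by positivity), abs_one]
    linarith
  have hv2 : ‖(⟨1 / c, -1⟩ : ℂ)‖ ≤ 2 := by
    refine (Complex.norm_le_abs_re_add_abs_im _).trans ?_
    rw [abs_of_pos (by positivity), abs_neg, abs_one]
    linarith
  have e1 := hslant (-(1 / n : ℝ)) ⟨1 / c, 1⟩ (by simp [-one_div]) rfl hv1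
    (Or.inl ⟨by simp [-one_div], rfl⟩)
  have e2 := hslant (-(1 / n : ℝ) + 2 * Real.pi * Complex.I) ⟨1 / c, -1⟩ (by simp [-one_div]) rfl
    hv2 (Or.inr ⟨by simp [-one_div], rfl⟩)
  -- the vertical segment
  set p : ℂ := ⟨b / c - 1 / n, b⟩ with hp
  set q : ℂ := ⟨b / c - 1 / n, 2 * Real.pi - b⟩ with hq
  have ep : -(1 / n : ℝ) + b * (⟨1 / c, 1⟩ : ℂ) = p := by
    apply Complex.ext
    · simp [-one_div, hp]; ring
    · simp [-one_div, hp]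
  have eq : -(1 / n : ℝ) + 2 * Real.pi * Complex.I + b * (⟨1 / c, -1⟩ : ℂ) = q := by
    apply Complex.ext
    · simp [-one_div, hq]; ring
    · simp [-one_div, hq]; ring
  rw [ep] at e1
  rw [eq] at e2
  have hpq : ‖H q - H p‖ ≤ 2 * Real.pi * (Real.exp 1 * M₂ * Real.exp (-(n * b / c))) := by
    have hseg : ∀ w ∈ segment ℝ p q, w.re = b / c - 1 / n ∧ b ≤ w.im ∧ w.im ≤ 2 * Real.pi - b := by
      rintro w ⟨x, y, hx, hy, hxy, rfl⟩
      refine ⟨?_, ?_, ?_⟩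
      · simp [-one_div, hp, hq]
        rw [← add_mul, hxy, one_mul]
      · simp [-one_div, hp, hq]
        nlinarith
      · simp [-one_div, hp, hq]
        nlinarith
    have h2 := (convex_segment p q).norm_image_sub_le_of_norm_hasDerivWithin_le (𝕜 := ℂ) (f := H)
      (f' := fun w => W (Complex.exp w) * Complex.exp (-(n * w)))
      (C := Real.exp 1 * M₂ * Real.exp (-(n * b / c)))
      (fun w hw => (hH w (hreg b hb0 le_rfl w (hseg w hw).1 (hseg w hw).2.1
        (hseg w hw).2.2)).hasDerivWithinAt) (fun w hw => ?_)
      (left_mem_segment ℝ p q) (right_mem_segment ℝ p q)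
    · have h3 : ‖q - p‖ ≤ 2 * Real.pi := by
        refine (Complex.norm_le_abs_re_add_abs_im _).trans ?_
        simp [-one_div, hp, hq]
        rw [abs_of_nonneg (by linarith)]
        linarith
      rw [mul_comm (2 * Real.pi)]
      exact h2.trans (by gcongr)
    · obtain ⟨g1, g2, g3⟩ := hseg w hw
      rw [norm_mul, hGnorm w b g1]
      calc _ ≤ M₂ * (Real.exp 1 * Real.exp (-(n * b / c))) := by
            gcongr
            exact hv w g1 g2 g3
        _ = _ := by ring
  have hfin : 2 * Real.pi * ‖taylorCoeff W n‖ ≤ 2 * (4 * Real.exp 1 * c * (M₁ / n)) +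
      2 * Real.pi * (Real.exp 1 * M₂ * Real.exp (-(n * b / c))) := by
    have e3 := congrArg norm hHn
    rw [norm_mul, norm_mul, norm_mul, Complex.norm_I, Complex.norm_real, Real.norm_eq_abs,
      abs_of_pos Real.pi_pos, Complex.norm_ofNat, mul_one] at e3
    rw [← e3]
    have : H (-(1 / n : ℝ) + 2 * Real.pi * Complex.I) - H (-(1 / n : ℝ)) =
        (H p - H (-(1 / n : ℝ))) + (H q - H p) -
          (H q - H (-(1 / n : ℝ) + 2 * Real.pi * Complex.I)) := by ring
    rw [this]
    refine (norm_sub_le _ _).trans ?_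
    have := norm_add_le (H p - H (-(1 / n : ℝ))) (H q - H p)
    linarith
  have h5 : 0 ≤ Real.exp 1 * c * (M₁ / n) := by positivity
  have h6 : 2 * Real.pi * ‖taylorCoeff W n‖ ≤ 2 * Real.pi *
      (8 * Real.exp 1 * c * (M₁ / n) + Real.exp 1 * M₂ * Real.exp (-(n * b / c))) := by
    nlinarith
  exact le_of_mul_le_mul_left h6 (by positivity)

/-! ### Bounds on the weights from the singularity of the generating function -/

/-- The analytic hypotheses on the generating function, normalized to radius of convergence `1`. -/
structure SingularityData (θ : ℕ → ℝ) (ϑ K : ℝ) (g : ℂ → ℂ) (R φ : ℝ) : Prop where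
  nonneg : ∀ m, 1 ≤ m → 0 ≤ θ m
  exponent_pos : 0 < ϑ
  one_lt : 1 < R
  angle_pos : 0 < φ
  angle_lt : φ < Real.pi / 2
  diff : DifferentiableOn ℂ g (Delta0 1 R φ)
  near : ∃ C δ : ℝ, 0 ≤ C ∧ 0 < δ ∧ ∀ z ∈ Delta0 1 R φ, ‖z - 1‖ < δ →
    ‖g z - (ϑ * Complex.log (1 / (1 - z)) + K)‖ ≤ C * ‖z - 1‖
  hasSum : ∀ᶠ z in 𝓝 (0 : ℂ), HasSum (fun m : ℕ => ((θ m / m : ℝ) : ℂ) * z ^ m) (g z)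

theorem one_sub_mem_slitPlane {R φ : ℝ} {z : ℂ} (h0 : 0 < φ) (hz : z ∈ Delta0 1 R φ) :
    1 - z ∈ Complex.slitPlane := by
  obtain ⟨-, h1, h2⟩ := hz
  rw [Complex.ofReal_one] at h1 h2
  rw [Complex.mem_slitPlane_iff_arg]
  refine ⟨fun h => ?_, sub_ne_zero.2 (Ne.symm h1)⟩
  rw [Complex.arg_eq_pi_iff] at h
  have h3 : Complex.arg (z - 1) = 0 := by
    rw [Complex.arg_eq_zero_iff]
    simp at h ⊢
    exact ⟨by linarith [h.1], h.2⟩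
  rw [h3, abs_zero] at h2
  linarith

theorem norm_exp_sub_one_le_mul_exp (u : ℂ) : ‖Complex.exp u - 1‖ ≤ ‖u‖ * Real.exp ‖u‖ := by
  simpa using Complex.norm_exp_sub_sum_le_norm_mul_exp u 1

namespace SingularityData

variable {θ : ℕ → ℝ} {ϑ K : ℝ} {g : ℂ → ℂ} {R φ : ℝ}

theorem coeff_nonneg (h : SingularityData θ ϑ K g R φ) (m : ℕ) : 0 ≤ θ m / m := by
  rcases Nat.eq_zero_or_pos m with rfl | hm
  · simp
  · exact div_nonneg (h.nonneg m hm) (Nat.cast_nonneg m)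

/-- The series is only assumed to represent `g` near `0`; holomorphy on the unit disc, which lies in
`Δ₀`, extends this to the whole disc. -/
theorem hasSum_of_norm_lt (h : SingularityData θ ϑ K g R φ) {z : ℂ} (hz : ‖z‖ < 1) :
    HasSum (fun m : ℕ => ((θ m / m : ℝ) : ℂ) * z ^ m) (g z) := by
  have hd : DifferentiableOn ℂ g (Metric.ball 0 1) :=
    h.diff.mono (ball_subset_Delta0 h.one_lt h.angle_pos h.angle_lt)
  have h1 := Complex.hasSum_taylorSeries_on_ball hd (mem_ball_zero_iff.2 hz)
  refine h1.congr_fun fun m => ?_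
  rw [← taylorCoeff_of_hasSum h.hasSum m, taylorCoeff]
  simp only [smul_eq_mul, sub_zero]
  ring

theorem hasSum_real (h : SingularityData θ ϑ K g R φ) {t : ℝ} (h0 : 0 ≤ t) (h1 : t < 1) :
    HasSum (fun m : ℕ => θ m / m * t ^ m) (g t).re := by
  have h2 := h.hasSum_of_norm_lt (z := t) (by
    rwa [Complex.norm_real, Real.norm_eq_abs, abs_of_nonneg h0])
  have h3 := Complex.hasSum_re h2
  refine h3.congr_fun fun m => ?_
  rw [← Complex.ofReal_pow, ← Complex.ofReal_mul, Complex.ofReal_re]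

/-- On `[0, 1)`, the generating function is `-ϑ log (1 - t)` up to a bounded error. -/
theorem exists_abs_re_add_log_le (h : SingularityData θ ϑ K g R φ) :
    ∃ C : ℝ, 0 ≤ C ∧ ∀ t : ℝ, 0 ≤ t → t < 1 → |(g t).re + ϑ * Real.log (1 - t)| ≤ C := by
  obtain ⟨C, δ, hC, hδ, hnear⟩ := h.near
  have hsub := ball_subset_Delta0 h.one_lt h.angle_pos h.angle_lt
  have hmem : ∀ t : ℝ, 0 ≤ t → t < 1 → (t : ℂ) ∈ Metric.ball (0 : ℂ) 1 := by
    intro t h0 h1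
    rwa [mem_ball_zero_iff, Complex.norm_real, Real.norm_eq_abs, abs_of_nonneg h0]
  have hcont : ContinuousOn (fun t : ℝ => (g t).re + ϑ * Real.log (1 - t))
      (Set.Icc 0 (1 - δ)) := by
    have hg : ContinuousOn (fun t : ℝ => g t) (Set.Icc 0 (1 - δ)) :=
      h.diff.continuousOn.comp Complex.continuous_ofReal.continuousOn
        fun t ht => hsub (hmem t ht.1 (by linarith [ht.2]))
    refine (Complex.continuous_re.comp_continuousOn hg).add (continuousOn_const.mul ?_)
    refine ContinuousOn.log (by fun_prop) fun t ht => ?_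
    have := ht.2
    linarith
  obtain ⟨C', hC'⟩ := isCompact_Icc.exists_bound_of_continuousOn hcont
  refine ⟨max C' (|K| + C * δ), le_max_of_le_right (by positivity), fun t h0 h1 => ?_⟩
  rcases le_or_gt t (1 - δ) with ht | ht
  · exact (hC' t ⟨h0, ht⟩).trans (le_max_left _ _)
  · refine le_max_of_le_right ?_
    have hn : ‖(t : ℂ) - 1‖ = 1 - t := by
      rw [← Complex.ofReal_one, ← Complex.ofReal_sub, Complex.norm_real, Real.norm_eq_abs,
        abs_of_neg (by linarith)]
      ring
    have h2 := hnear t (hsub (hmem t h0 h1)) (by rw [hn]; linarith)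
    have h3 : (g t - (ϑ * Complex.log (1 / (1 - t)) + K)).re =
        (g t).re + ϑ * Real.log (1 - t) - K := by
      have : (1 / (1 - t) : ℂ) = ((1 / (1 - t) : ℝ) : ℂ) := by push_cast; rfl
      rw [this, ← Complex.ofReal_log (by
        have : 0 < 1 - t := by linarith
        positivity), ← Complex.ofReal_mul, ← Complex.ofReal_add, Complex.sub_re,
        Complex.ofReal_re, one_div, Real.log_inv]
      ring
    have h4 := (Complex.abs_re_le_norm _).trans h2
    rw [h3, hn] at h4
    have h5 : C * (1 - t) ≤ C * δ := by gcongr; linarith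
    have h6 := abs_sub_abs_le_abs_sub ((g t).re + ϑ * Real.log (1 - t)) K
    linarith

theorem sum_le_re (h : SingularityData θ ϑ K g R φ) (s : Finset ℕ) {t : ℝ} (h0 : 0 ≤ t)
    (h1 : t < 1) : ∑ m ∈ s, θ m / m * t ^ m ≤ (g t).re :=
  sum_le_hasSum s (fun m _ => mul_nonneg (h.coeff_nonneg m) (by positivity)) (h.hasSum_real h0 h1)

/-- Tauberian argument using `θ ≥ 0`: for `t = e^{-1/d}` the difference `g t - g (t^2)` is bounded,
since the logarithms differ by `ϑ log (1 + t)`. Its terms are nonnegative and, for `m ≤ d`, at least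
`e^{-2} θ_m / d`. -/
theorem exists_sum_theta_le (h : SingularityData θ ϑ K g R φ) :
    ∃ C : ℝ, 0 ≤ C ∧ ∀ d : ℕ, 1 ≤ d → ∑ m ∈ Icc 1 d, θ m ≤ C * d := by
  obtain ⟨C, hC, hb⟩ := h.exists_abs_re_add_log_le
  have hϑ := h.exponent_pos
  refine ⟨Real.exp 2 * (2 * C + ϑ), by positivity, fun d hd => ?_⟩
  have hd0 : (0 : ℝ) < d := by positivity
  set t := Real.exp (-(1 / d)) with ht
  have ht0 : 0 < t := Real.exp_pos _
  have ht1 : t < 1 := Real.exp_lt_one_iff.2 (by simp; omega)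
  have htt : t ^ 2 < 1 := by nlinarith
  have hs := (h.hasSum_real ht0.le ht1).sub (h.hasSum_real (by positivity : 0 ≤ t ^ 2) htt)
  have hpow : ∀ m : ℕ, (t ^ 2) ^ m ≤ t ^ m := fun m => by
    have : t ^ 2 ≤ t := by nlinarith
    gcongr
  have h1 := sum_le_hasSum (Icc 1 d) (fun m _ => by
    rw [← mul_sub]
    exact mul_nonneg (h.coeff_nonneg m) (sub_nonneg.2 (hpow m))) hs
  have h2 : (g t).re - (g ((t ^ 2 : ℝ) : ℂ)).re ≤ 2 * C + ϑ := by
    have e1 := abs_le.1 (hb t ht0.le ht1)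
    have e2 := abs_le.1 (hb (t ^ 2) (by positivity) htt)
    have e3 : Real.log (1 - t ^ 2) = Real.log (1 - t) + Real.log (1 + t) := by
      rw [← Real.log_mul (by linarith) (by linarith)]
      congr 1
      ring
    have e4 : Real.log (1 + t) ≤ 1 := by
      have := Real.log_le_sub_one_of_pos (show 0 < 1 + t by linarith)
      linarith
    rw [e3] at e2
    nlinarith [e1.1, e1.2, e2.1, e2.2]
  have h3 : ∑ m ∈ Icc 1 d, θ m * (Real.exp (-2) / d) ≤ 2 * C + ϑ := by
    refine le_trans (Finset.sum_le_sum fun m hm => ?_) (h1.trans h2)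
    obtain ⟨hm1, hm2⟩ := Finset.mem_Icc.1 hm
    have hm0 : (0 : ℝ) < m := by positivity
    have hmd : (m : ℝ) / d ≤ 1 := by
      rw [div_le_one hd0]; exact_mod_cast hm2
    have e1 : t ^ m = Real.exp (-(m / d)) := by
      rw [ht, ← Real.exp_nat_mul]; congr 1; ring
    have e2 : (m / d : ℝ) * Real.exp (-2) ≤ t ^ m - (t ^ 2) ^ m := by
      rw [← pow_mul, mul_comm 2 m, pow_mul, e1]
      set v : ℝ := m / d
      have e3 : Real.exp (-v) * Real.exp v = 1 := by rw [← Real.exp_add]; simp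
      have e4 := Real.add_one_le_exp v
      have e5 := Real.exp_pos (-v)
      have e6 : v * Real.exp (-v) ≤ 1 - Real.exp (-v) := by nlinarith
      have e7 : Real.exp (-2) ≤ Real.exp (-v) ^ 2 := by
        rw [← Real.exp_nat_mul]
        apply Real.exp_le_exp.2
        push_cast
        linarith
      have e8 : 0 ≤ v := by positivity
      nlinarith [mul_le_mul_of_nonneg_left e7 e8, mul_le_mul_of_nonneg_left e6 e5.le]
    calc θ m * (Real.exp (-2) / d) = θ m / m * ((m / d : ℝ) * Real.exp (-2)) := by field_simp
      _ ≤ θ m / m * (t ^ m - (t ^ 2) ^ m) := by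
        gcongr
        exact h.coeff_nonneg m
      _ = _ := by ring
  rw [← Finset.sum_mul] at h3
  have e : Real.exp 2 * Real.exp (-2) = 1 := by rw [← Real.exp_add]; simp
  calc ∑ m ∈ Icc 1 d, θ m = ((∑ m ∈ Icc 1 d, θ m) * (Real.exp (-2) / d)) * (Real.exp 2 * d) := by
        rw [show ((∑ m ∈ Icc 1 d, θ m) * (Real.exp (-2) / d)) * (Real.exp 2 * d) =
          (∑ m ∈ Icc 1 d, θ m) * (Real.exp 2 * Real.exp (-2)) by field_simp, e, mul_one]
    _ ≤ (2 * C + ϑ) * (Real.exp 2 * d) := by gcongr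
    _ = _ := by ring

/-- At `t = e^{-1/d}` one has `g t ≤ ϑ log d + O(1)`, while `t ^ m ≥ e^{-1}` for `m ≤ d`. -/
theorem exists_sum_theta_div_le (h : SingularityData θ ϑ K g R φ) :
    ∃ C : ℝ, 0 ≤ C ∧ ∀ d : ℕ, 1 ≤ d → ∑ m ∈ Icc 1 d, θ m / m ≤ C * (1 + Real.log d) := by
  obtain ⟨C, hC, hb⟩ := h.exists_abs_re_add_log_le
  have hϑ := h.exponent_pos
  refine ⟨Real.exp 1 * (C + ϑ), by positivity, fun d hd => ?_⟩
  have hd0 : (0 : ℝ) < d := by positivity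
  have hld : 0 ≤ Real.log d := Real.log_natCast_nonneg d
  set t := Real.exp (-(1 / d)) with ht
  have ht0 : 0 < t := Real.exp_pos _
  have ht1 : t < 1 := Real.exp_lt_one_iff.2 (by simp; omega)
  have hd1 : (1 / d : ℝ) ≤ 1 := by
    rw [div_le_one hd0]; exact_mod_cast hd
  have h1 := h.sum_le_re (Icc 1 d) ht0.le ht1
  have h2 : -Real.log (1 - t) ≤ 1 + Real.log d := by
    have e1 : Real.exp (-1) / d ≤ 1 - t := by
      have e2 : (1 / d : ℝ) + 1 ≤ Real.exp (1 / d) := Real.add_one_le_exp _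
      have e3 : t * Real.exp (1 / d) = 1 := by rw [ht, ← Real.exp_add]; simp
      have e4 : Real.exp (-1) ≤ t := Real.exp_le_exp.2 (by linarith)
      have e5 : (0 : ℝ) < 1 / d := by positivity
      rw [div_eq_mul_one_div]
      nlinarith [mul_le_mul_of_nonneg_right e4 e5.le]
    have e6 := Real.log_le_log (by positivity) e1
    rw [Real.log_div (Real.exp_pos _).ne' hd0.ne', Real.log_exp] at e6
    linarith
  have h3 : Real.exp (-1) * ∑ m ∈ Icc 1 d, θ m / m ≤ (g t).re := by
    refine le_trans ?_ h1
    rw [Finset.mul_sum]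
    refine Finset.sum_le_sum fun m hm => ?_
    obtain ⟨hm1, hm2⟩ := Finset.mem_Icc.1 hm
    rw [mul_comm]
    have : Real.exp (-1) ≤ t ^ m := by
      rw [ht, ← Real.exp_nat_mul]
      apply Real.exp_le_exp.2
      have : (m : ℝ) / d ≤ 1 := by
        rw [div_le_one hd0]; exact_mod_cast hm2
      rw [mul_neg, mul_one_div]
      linarith
    exact mul_le_mul_of_nonneg_left this (h.coeff_nonneg m)
  have h4 : (g t).re ≤ (C + ϑ) * (1 + Real.log d) := by
    have := (abs_le.1 (hb t ht0.le ht1)).2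
    nlinarith [mul_le_mul_of_nonneg_left h2 hϑ.le, mul_nonneg hC hld]
  have e : Real.exp 1 * Real.exp (-1) = 1 := by rw [← Real.exp_add]; simp
  calc _ = Real.exp 1 * (Real.exp (-1) * ∑ m ∈ Icc 1 d, θ m / m) := by
        rw [← mul_assoc, e, one_mul]
    _ ≤ Real.exp 1 * ((C + ϑ) * (1 + Real.log d)) :=
        mul_le_mul_of_nonneg_left (h3.trans h4) (Real.exp_pos 1).le
    _ = _ := by ring

end SingularityData

/-! ### Bounds for `L_D` and elementary inequalities -/

/-- The polynomial `L_D` at a complex argument. -/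
def complexL (θ : ℕ → ℝ) (D : Finset ℕ) (z : ℂ) : ℂ := ∑ m ∈ D, ((θ m / m : ℝ) : ℂ) * z ^ m

theorem norm_complexL_le {θ : ℕ → ℝ} (hθ : ∀ m, 1 ≤ m → 0 ≤ θ m) {D : Finset ℕ} {d : ℕ}
    (hD : D ⊆ Icc 1 d) {z : ℂ} (hz : ‖z‖ ≤ Real.exp (1 / d)) :
    ‖complexL θ D z‖ ≤ Real.exp 1 * ∑ m ∈ Icc 1 d, θ m / m := by
  rw [Finset.mul_sum]
  refine (norm_sum_le _ _).trans ?_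
  have h0 : ∀ m ∈ Icc 1 d, 0 ≤ Real.exp 1 * (θ m / m) := fun m hm => by
    have := hθ m (Finset.mem_Icc.1 hm).1
    positivity
  refine le_trans (Finset.sum_le_sum fun m hm => ?_)
    (Finset.sum_le_sum_of_subset_of_nonneg hD fun m hm _ => h0 m hm)
  obtain ⟨hm1, hm2⟩ := Finset.mem_Icc.1 (hD hm)
  have hθm := hθ m hm1
  rw [norm_mul, norm_pow, Complex.norm_real, Real.norm_of_nonneg (by positivity), mul_comm]
  have hd0 : (0 : ℝ) < d := by exact_mod_cast (by omega : 0 < d)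
  have : ‖z‖ ^ m ≤ Real.exp 1 := by
    refine (pow_le_pow_left₀ (norm_nonneg z) hz m).trans ?_
    rw [← Real.exp_nat_mul]
    apply Real.exp_le_exp.2
    rw [mul_one_div, div_le_one hd0]
    exact_mod_cast hm2
  gcongr

/-- Factor `z^m - 1 = (z - 1) ∑_{i<m} z^i`: each power has norm at most `e`, and the `m` summands
cancel the denominator of `θ m / m`. -/
theorem norm_complexL_sub_le {θ : ℕ → ℝ} (hθ : ∀ m, 1 ≤ m → 0 ≤ θ m) {D : Finset ℕ} {d : ℕ}
    (hD : D ⊆ Icc 1 d) {z : ℂ} (hz : ‖z‖ ≤ Real.exp (1 / d)) :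
    ‖complexL θ D z - L θ D 1‖ ≤ Real.exp 1 * ‖z - 1‖ * ∑ m ∈ Icc 1 d, θ m := by
  have e : complexL θ D z - L θ D 1 = ∑ m ∈ D, ((θ m / m : ℝ) : ℂ) * (z ^ m - 1) := by
    rw [complexL, L]
    push_cast
    rw [← Finset.sum_sub_distrib]
    refine Finset.sum_congr rfl fun m _ => ?_
    simp
    ring
  rw [e, Finset.mul_sum]
  refine (norm_sum_le _ _).trans ?_
  have h0 : ∀ m ∈ Icc 1 d, 0 ≤ Real.exp 1 * ‖z - 1‖ * θ m := fun m hm => by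
    have := hθ m (Finset.mem_Icc.1 hm).1
    positivity
  refine le_trans (Finset.sum_le_sum fun m hm => ?_)
    (Finset.sum_le_sum_of_subset_of_nonneg hD fun m hm _ => h0 m hm)
  obtain ⟨hm1, hm2⟩ := Finset.mem_Icc.1 (hD hm)
  have hθm := hθ m hm1
  have hm0 : (0 : ℝ) < m := by positivity
  have hd0 : (0 : ℝ) < d := by exact_mod_cast (by omega : 0 < d)
  rw [norm_mul, Complex.norm_real, Real.norm_of_nonneg (by positivity)]
  have h1 : ‖z ^ m - 1‖ ≤ m * Real.exp 1 * ‖z - 1‖ := by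
    rw [← geom_sum_mul, norm_mul]
    gcongr
    refine (norm_sum_le _ _).trans ?_
    refine (Finset.sum_le_card_nsmul _ _ (Real.exp 1) fun i hi => ?_).trans (by simp)
    have hi' := Finset.mem_range.1 hi
    rw [norm_pow]
    refine (pow_le_pow_left₀ (norm_nonneg z) hz i).trans ?_
    rw [← Real.exp_nat_mul]
    apply Real.exp_le_exp.2
    rw [mul_one_div, div_le_one hd0]
    exact_mod_cast (by omega : i ≤ d)
  calc θ m / m * ‖z ^ m - 1‖ ≤ θ m / m * (m * Real.exp 1 * ‖z - 1‖) := by gcongr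
    _ = _ := by field_simp

/-- A linear bound `1 + u ≤ M e^{ku/q}` is raised to the power `q = |a| + 1`. It serves to absorb
`(1 + n s)^(1-ϑ)`, whatever the sign of `1 - ϑ`, in half of the contour decay. -/
theorem exists_one_add_rpow_le_exp (a : ℝ) {k : ℝ} (hk : 0 < k) :
    ∃ C : ℝ, 0 ≤ C ∧ ∀ u : ℝ, 0 ≤ u → (1 + u) ^ a ≤ C * Real.exp (k * u) := by
  set q : ℝ := |a| + 1 with hq
  have hq0 : 0 < q := by positivity
  set M : ℝ := max 1 (q / k) with hM
  have hM1 : 1 ≤ M := le_max_left _ _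
  refine ⟨M ^ q, by positivity, fun u hu => ?_⟩
  have h1 : (1 + u) ^ a ≤ (1 + u) ^ q :=
    Real.rpow_le_rpow_of_exponent_le (by linarith) (by linarith [le_abs_self a])
  have h2 : 1 + u ≤ M * Real.exp (k * u / q) := by
    have h3 := Real.add_one_le_exp (k * u / q)
    have h4 : u ≤ M * (k * u / q) := by
      have h5 : q / k ≤ M := le_max_right _ _
      calc u = q / k * (k * u / q) := by field_simp
        _ ≤ _ := by gcongr
    nlinarith
  calc (1 + u) ^ a ≤ (1 + u) ^ q := h1
    _ ≤ (M * Real.exp (k * u / q)) ^ q := by gcongr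
    _ = _ := by
      rw [Real.mul_rpow (by linarith) (Real.exp_pos _).le, ← Real.exp_mul]
      congr 2
      field_simp

theorem rpow_le_of_comparable {x X : ℝ} (hX : 0 < X) (h1 : X / 6 ≤ x) (h2 : x ≤ 6 * X) (a : ℝ) :
    x ^ a ≤ 6 ^ |a| * X ^ a := by
  have hx : 0 < x := by linarith
  rcases le_or_gt 0 a with ha | ha
  · rw [abs_of_nonneg ha, ← Real.mul_rpow (by norm_num) hX.le]
    gcongr
  · rw [abs_of_neg ha, Real.rpow_neg (by norm_num), ← Real.inv_rpow (by norm_num),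
      ← Real.mul_rpow (by norm_num) hX.le]
    apply Real.rpow_le_rpow_of_nonpos (by positivity) _ ha.le
    linarith

theorem norm_exp_sub_one_comparable {w : ℂ} {c s X : ℝ} (hc : 1 ≤ c) (hs : 0 ≤ s) (hX : 0 < X)
    (hsX : s + X ≤ 1 / 4) (hre : w.re = s / c - X) (him : |w.im| = s) :
    (s + X) / 6 ≤ ‖Complex.exp w - 1‖ ∧ ‖Complex.exp w - 1‖ ≤ 4 * (s + X) := by
  have h1 : |w.re| ≤ ‖w‖ := Complex.abs_re_le_norm w
  have h2 : |w.im| ≤ ‖w‖ := Complex.abs_im_le_norm w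
  have hsc : s / c ≤ s := div_le_self hs hc
  have hsc0 : 0 ≤ s / c := by positivity
  have h3 : (s + X) / 3 ≤ ‖w‖ := by
    rw [hre] at h1
    have := neg_abs_le (s / c - X)
    linarith
  have h4 : ‖w‖ ≤ 2 * (s + X) := by
    refine (Complex.norm_le_abs_re_add_abs_im w).trans ?_
    have : |w.re| ≤ s + X := by
      rw [hre, abs_le]
      constructor <;> linarith
    linarith
  have h5 := Complex.norm_exp_sub_one_le (x := w) (by linarith)
  have h6 := Complex.norm_exp_sub_one_sub_id_le (x := w) (by linarith)
  constructor
  · have h7 : ‖w‖ ≤ ‖Complex.exp w - 1‖ + ‖Complex.exp w - 1 - w‖ := by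
      have := norm_sub_le (Complex.exp w - 1) (Complex.exp w - 1 - w)
      simpa using this
    nlinarith [norm_nonneg w]
  · linarith

/-- From `|1 - e^w|^2 = (1 - e^x)^2 + 4 e^x sin^2 (y/2)` with `w = x + iy`; the sine is bounded
below by the parabola of `mul_le_sin`. -/
theorem le_norm_one_sub_exp {w : ℂ} {b : ℝ} (hb0 : 0 ≤ b) (hb1 : b ≤ 1) (hre : -1 ≤ w.re)
    (h1 : b ≤ w.im) (h2 : w.im ≤ 2 * Real.pi - b) : b / 4 ≤ ‖1 - Complex.exp w‖ := by
  have hpi := Real.pi_gt_three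
  have hpi4 := Real.pi_lt_four
  obtain ⟨u, hu⟩ : ∃ u, w.im = 2 * u := ⟨w.im / 2, by ring⟩
  rw [hu] at h1 h2
  have hsin := mul_le_sin (u := u) (by linarith) (by linarith)
  have h3 : b / 2 * (Real.pi - b / 2) ≤ u * (Real.pi - u) := by nlinarith
  have h4 : b / 8 ≤ Real.sin u / 2 := by
    have h5 : b / 4 ≤ 2 / Real.pi ^ 2 * (b / 2 * (Real.pi - b / 2)) := by
      rw [div_mul_eq_mul_div, le_div_iff₀ (by positivity)]
      have h6 : Real.pi ^ 2 ≤ 4 * (Real.pi - b / 2) := by nlinarith [Real.pi_lt_d2]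
      nlinarith [mul_le_mul_of_nonneg_left h6 hb0]
    have h6 : 2 / Real.pi ^ 2 * (b / 2 * (Real.pi - b / 2)) ≤
        2 / Real.pi ^ 2 * (u * (Real.pi - u)) := by gcongr
    linarith
  set x := w.re
  have hex : Real.exp (-1) ≤ Real.exp x := Real.exp_le_exp.2 hre
  have he1 : (1 / 4 : ℝ) ≤ Real.exp (-1) := by
    rw [Real.exp_neg, ← one_div]
    apply one_div_le_one_div_of_le (Real.exp_pos 1)
    linarith [Real.exp_one_lt_d9]
  have hsq : ‖1 - Complex.exp w‖ ^ 2 = (1 - Real.exp x) ^ 2 + 4 * Real.exp x * Real.sin u ^ 2 := by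
    rw [Complex.sq_norm, Complex.normSq_apply]
    simp only [Complex.sub_re, Complex.sub_im, Complex.one_re, Complex.one_im, Complex.exp_re,
      Complex.exp_im, hu, Real.cos_two_mul, Real.sin_two_mul]
    change (1 - Real.exp x * (2 * Real.cos u ^ 2 - 1)) * (1 - Real.exp x * (2 * Real.cos u ^ 2 - 1))
      + (0 - Real.exp x * (2 * Real.sin u * Real.cos u)) *
        (0 - Real.exp x * (2 * Real.sin u * Real.cos u)) = _
    have h7 : Real.cos u ^ 2 = 1 - Real.sin u ^ 2 := by
      have := Real.sin_sq_add_cos_sq u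
      linarith
    linear_combination (4 * Real.exp x ^ 2 * Real.cos u ^ 2 - 4 * Real.exp x + 4 * Real.exp x ^ 2 *
      Real.sin u ^ 2 - 4 * Real.exp x ^ 2 + 4 * Real.exp x ^ 2 * (1 - Real.sin u ^ 2)) * h7
  refine (pow_le_pow_iff_left₀ (by positivity) (norm_nonneg _) two_ne_zero).1 ?_
  rw [hsq]
  have h8 : (b / 4) ^ 2 ≤ Real.sin u ^ 2 := by
    have : b / 4 ≤ Real.sin u := by linarith
    gcongr
  nlinarith [sq_nonneg (1 - Real.exp x), sq_nonneg (Real.sin u)]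

/-! ### Bounds for `exp g` -/

namespace SingularityData

variable {θ : ℕ → ℝ} {ϑ K : ℝ} {g : ℂ → ℂ} {R φ : ℝ}

/-- Near the singularity, `exp g` is `e^K (1 - z)^(-ϑ)` up to a factor `1 + O(1 - z)`. -/
theorem exists_norm_exp_sub_le (h : SingularityData θ ϑ K g R φ) :
    ∃ C δ : ℝ, 0 ≤ C ∧ 0 < δ ∧ ∀ z ∈ Delta0 1 R φ, ‖1 - z‖ < δ →
      ‖Complex.exp (g z) - Real.exp K * (1 - z) ^ (-(ϑ : ℂ))‖ ≤ C * ‖1 - z‖ ^ (1 - ϑ) := by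
  obtain ⟨C, δ, hC, hδ, hnear⟩ := h.near
  refine ⟨Real.exp K * (C * Real.exp (C * δ)), δ, by positivity, hδ, fun z hz hzδ => ?_⟩
  have hslit := one_sub_mem_slitPlane h.angle_pos hz
  have hne : 1 - z ≠ 0 := Complex.slitPlane_ne_zero hslit
  have hpos : 0 < ‖1 - z‖ := norm_pos_iff.2 hne
  have h1 := hnear z hz (by rwa [norm_sub_rev])
  rw [norm_sub_rev z 1] at h1
  set u := g z - (ϑ * Complex.log (1 / (1 - z)) + K) with hu
  have hg : g z = K + (-(ϑ : ℂ)) * Complex.log (1 - z) + u := by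
    rw [hu, one_div, Complex.log_inv _ (Complex.slitPlane_arg_ne_pi hslit)]
    ring
  have he : Complex.exp (g z) - Real.exp K * (1 - z) ^ (-(ϑ : ℂ)) =
      Real.exp K * (1 - z) ^ (-(ϑ : ℂ)) * (Complex.exp u - 1) := by
    rw [hg, Complex.exp_add, Complex.exp_add, Complex.cpow_def_of_ne_zero hne, Complex.ofReal_exp,
      mul_comm (Complex.log _)]
    ring
  rw [he, norm_mul, norm_mul, Complex.norm_real, Real.norm_of_nonneg (Real.exp_pos K).le,
    ← Complex.ofReal_neg, Complex.norm_cpow_real]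
  have h2 : ‖Complex.exp u - 1‖ ≤ C * ‖1 - z‖ * Real.exp (C * δ) := by
    refine (norm_exp_sub_one_le_mul_exp u).trans ?_
    have : ‖u‖ ≤ C * δ := h1.trans (by gcongr)
    gcongr
  calc _ ≤ Real.exp K * ‖1 - z‖ ^ (-ϑ) * (C * ‖1 - z‖ * Real.exp (C * δ)) := by gcongr
    _ = Real.exp K * (C * Real.exp (C * δ)) * (‖1 - z‖ ^ (-ϑ) * ‖1 - z‖) := by ring
    _ = _ := by
      rw [← Real.rpow_add_one hpos.ne', show -ϑ + 1 = 1 - ϑ by ring]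

/-- Bound for `exp g` on the image of the closed region bounded by the contour. -/
theorem exists_norm_exp_le (h : SingularityData θ ϑ K g R φ) {c : ℝ} (hc : 1 ≤ c)
    (hexp : ∀ w ∈ logDisc c, Complex.exp w ∈ Delta0 1 R φ) :
    ∃ C : ℝ, 0 ≤ C ∧ ∀ w : ℂ, -1 ≤ w.re → w.re ≤ 1 / c → c * w.re ≤ w.im →
      w.im ≤ 2 * Real.pi - c * w.re → 0 ≤ w.im → w.im ≤ 2 * Real.pi → Complex.exp w ≠ 1 →
      ‖Complex.exp (g (Complex.exp w))‖ ≤ C * ‖1 - Complex.exp w‖ ^ (-ϑ) := by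
  obtain ⟨C, δ, hC, hδ, hnear⟩ := h.exists_norm_exp_sub_le
  have hϑ := h.exponent_pos
  have hpi := Real.pi_gt_three
  have hc0 : 0 < c := by linarith
  -- On `S` the exponential takes the value `1` only at `0` and `2πi`, the two points where `S`
  -- meets the boundary of the disc. Near them the local expansion applies, and the rest of `S` is
  -- compact.
  set S : Set ℂ := {w | -1 ≤ w.re ∧ w.re ≤ 1 / c ∧ c * w.re ≤ w.im ∧
      w.im ≤ 2 * Real.pi - c * w.re ∧ 0 ≤ w.im ∧ w.im ≤ 2 * Real.pi} with hS
  have hSd : ∀ w ∈ S, Complex.exp w ≠ 1 → w ∈ logDisc c := by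
    rintro w ⟨s1, s2, s3, s4, s5, s6⟩ hw
    rw [mem_logDisc]
    rcases lt_trichotomy w.re 0 with hx | hx | hx
    · nlinarith [mul_nonneg s5 (sub_nonneg.2 s6)]
    · rw [hx]
      have h0 : w.im ≠ 0 := by
        rintro h0
        exact hw (by rw [show w = 0 from Complex.ext hx h0, Complex.exp_zero])
      have h1 : w.im ≠ 2 * Real.pi := by
        rintro h0
        refine hw ?_
        rw [show w = 2 * Real.pi * Complex.I from Complex.ext (by simp [hx]) (by simp [h0]),
          Complex.exp_two_pi_mul_I]
      have h2 : 0 < w.im := lt_of_le_of_ne s5 (Ne.symm h0)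
      have h3 : w.im < 2 * Real.pi := lt_of_le_of_ne s6 h1
      have := mul_pos h2 (sub_pos.2 h3)
      linarith
    · have h4 : c * w.re ≤ 1 := by
        rw [le_div_iff₀ hc0] at s2
        linarith
      have h5 : w.re ≤ c * w.re := by nlinarith
      have h6 : c * w.re * (2 * Real.pi - c * w.re) ≤ w.im * (2 * Real.pi - w.im) := by nlinarith
      nlinarith [mul_pos hc0 hx]
  have hScomp : IsCompact (S ∩ {w | δ ≤ ‖1 - Complex.exp w‖}) := by
    apply Metric.isCompact_of_isClosed_isBounded
    · refine IsClosed.inter ?_ (isClosed_le (by fun_prop) (by fun_prop))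
      simp only [hS, Set.ofPred_and]
      refine (isClosed_le (by fun_prop) (by fun_prop)).inter <|
        (isClosed_le (by fun_prop) (by fun_prop)).inter <|
        (isClosed_le (by fun_prop) (by fun_prop)).inter <|
        (isClosed_le (by fun_prop) (by fun_prop)).inter <|
        (isClosed_le (by fun_prop) (by fun_prop)).inter <|
        (isClosed_le (by fun_prop) (by fun_prop))
    · refine (Metric.isBounded_closedBall (x := (0 : ℂ)) (r := 1 + 2 * Real.pi)).subset ?_
      rintro w ⟨⟨s1, s2, s3, s4, s5, s6⟩, -⟩
      rw [mem_closedBall_zero_iff]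
      refine (Complex.norm_le_abs_re_add_abs_im w).trans ?_
      rw [abs_of_nonneg s5]
      have : 1 / c ≤ 1 := by rw [div_le_one hc0]; exact hc
      have : |w.re| ≤ 1 := abs_le.2 ⟨s1, by linarith⟩
      linarith
  have hcont : ContinuousOn (fun w => Complex.exp (g (Complex.exp w)))
      (S ∩ {w | δ ≤ ‖1 - Complex.exp w‖}) := by
    refine Complex.continuous_exp.comp_continuousOn (h.diff.continuousOn.comp
      Complex.continuous_exp.continuousOn ?_)
    rintro w ⟨hw, hw2⟩
    refine hexp w (hSd w hw ?_)
    intro he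
    rw [Set.mem_ofPred_eq, he] at hw2
    simp at hw2
    linarith
  obtain ⟨B, hB⟩ := hScomp.exists_bound_of_continuousOn hcont
  refine ⟨max (max B 0 * 4 ^ ϑ) (C * δ + Real.exp K),
    le_max_of_le_right (by positivity), fun w s1 s2 s3 s4 s5 s6 hw => ?_⟩
  have hwS : w ∈ S := ⟨s1, s2, s3, s4, s5, s6⟩
  have hpos : 0 < ‖1 - Complex.exp w‖ := norm_pos_iff.2 (sub_ne_zero.2 (Ne.symm hw))
  have hppos : 0 < ‖1 - Complex.exp w‖ ^ (-ϑ) := by positivity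
  rcases lt_or_ge ‖1 - Complex.exp w‖ δ with hlt | hge
  · have h1 := hnear _ (hexp w (hSd w hwS hw)) hlt
    have h2 : ‖Complex.exp (g (Complex.exp w))‖ ≤
        ‖Complex.exp (g (Complex.exp w)) - Real.exp K * (1 - Complex.exp w) ^ (-(ϑ : ℂ))‖ +
        ‖Real.exp K * (1 - Complex.exp w) ^ (-(ϑ : ℂ))‖ := by
      have := norm_add_le (Complex.exp (g (Complex.exp w)) -
        Real.exp K * (1 - Complex.exp w) ^ (-(ϑ : ℂ)))
        (Real.exp K * (1 - Complex.exp w) ^ (-(ϑ : ℂ)))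
      rwa [sub_add_cancel] at this
    have h3 : ‖(Real.exp K : ℂ) * (1 - Complex.exp w) ^ (-(ϑ : ℂ))‖ =
        Real.exp K * ‖1 - Complex.exp w‖ ^ (-ϑ) := by
      rw [norm_mul, Complex.norm_real, Real.norm_of_nonneg (Real.exp_pos K).le,
        ← Complex.ofReal_neg, Complex.norm_cpow_real]
    have h4 : ‖1 - Complex.exp w‖ ^ (1 - ϑ) = ‖1 - Complex.exp w‖ ^ (-ϑ) * ‖1 - Complex.exp w‖ := by
      rw [← Real.rpow_add_one hpos.ne', show -ϑ + 1 = 1 - ϑ by ring]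
    have h5 : C * ‖1 - Complex.exp w‖ ^ (1 - ϑ) ≤ C * (‖1 - Complex.exp w‖ ^ (-ϑ) * δ) := by
      rw [h4]; gcongr
    calc ‖Complex.exp (g (Complex.exp w))‖
        ≤ (C * δ + Real.exp K) * ‖1 - Complex.exp w‖ ^ (-ϑ) := by
          rw [h3] at h2
          linarith
      _ ≤ _ := by gcongr; exact le_max_right _ _
  · have h1 := (hB w ⟨hwS, hge⟩).trans (le_max_left B 0)
    have h2 : ‖1 - Complex.exp w‖ ≤ 4 := by
      refine (norm_sub_le _ _).trans ?_
      rw [norm_one, Complex.norm_exp]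
      have h3 : w.re ≤ 1 := s2.trans (by rw [div_le_one hc0]; exact hc)
      have h4 := Real.exp_le_exp.2 h3
      linarith [Real.exp_one_lt_d9]
    have h3 : (4 : ℝ) ^ (-ϑ) ≤ ‖1 - Complex.exp w‖ ^ (-ϑ) :=
      Real.rpow_le_rpow_of_nonpos hpos h2 (by linarith)
    have h4 : (4 : ℝ) ^ ϑ * 4 ^ (-ϑ) = 1 := by
      rw [← Real.rpow_add (by norm_num)]; simp
    calc ‖Complex.exp (g (Complex.exp w))‖ ≤ max B 0 * (4 ^ ϑ * 4 ^ (-ϑ)) := by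
          rw [h4, mul_one]; exact h1
      _ ≤ max B 0 * (4 ^ ϑ * ‖1 - Complex.exp w‖ ^ (-ϑ)) := by gcongr
      _ = max B 0 * 4 ^ ϑ * ‖1 - Complex.exp w‖ ^ (-ϑ) := by ring
      _ ≤ _ := by gcongr; exact le_max_left _ _

end SingularityData

/-! ### The remainder and its Taylor coefficients, uniformly in `D` -/

/-- The difference between the normalized generating function of the cycle-restricted weights and
its singular part. -/
def remainder (θ : ℕ → ℝ) (ϑ K : ℝ) (g : ℂ → ℂ) (D : Finset ℕ) (z : ℂ) : ℂ :=
  Complex.exp (L θ D 1 : ℝ) * Complex.exp (g z - complexL θ D z) -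
    Real.exp K * (1 - z) ^ (-(ϑ : ℂ))

theorem differentiable_complexL (θ : ℕ → ℝ) (D : Finset ℕ) :
    Differentiable ℂ (complexL θ D) := by
  unfold complexL
  fun_prop

namespace SingularityData

variable {θ : ℕ → ℝ} {ϑ K : ℝ} {g : ℂ → ℂ} {R φ : ℝ}

theorem differentiableOn_one_sub_cpow {a : ℂ} (h0 : 0 < φ) :
    DifferentiableOn ℂ (fun z : ℂ => (1 - z) ^ a) (Delta0 1 R φ) := fun _ hz =>
  ((differentiableAt_id.const_sub (1 : ℂ)).cpow_const
    (one_sub_mem_slitPlane h0 hz)).differentiableWithinAt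

theorem differentiableOn_exp_sub (h : SingularityData θ ϑ K g R φ) (D : Finset ℕ) :
    DifferentiableOn ℂ (fun z => Complex.exp (g z - complexL θ D z)) (Delta0 1 R φ) :=
  (h.diff.sub (differentiable_complexL θ D).differentiableOn).cexp

theorem differentiableOn_remainder (h : SingularityData θ ϑ K g R φ) (D : Finset ℕ) :
    DifferentiableOn ℂ (remainder θ ϑ K g D) (Delta0 1 R φ) :=
  ((h.differentiableOn_exp_sub D).const_mul _).sub
    ((differentiableOn_one_sub_cpow h.angle_pos).const_mul _)

theorem exists_norm_remainder_le_near (h : SingularityData θ ϑ K g R φ) :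
    ∃ C δ : ℝ, 0 ≤ C ∧ 0 < δ ∧ ∀ d : ℕ, 1 ≤ d → ∀ D ⊆ Icc 1 d, ∀ z ∈ Delta0 1 R φ,
      ‖1 - z‖ < δ → ‖1 - z‖ ≤ 8 / d → ‖z‖ ≤ Real.exp (1 / d) →
      ‖remainder θ ϑ K g D z‖ ≤ C * d * ‖1 - z‖ ^ (1 - ϑ) := by
  obtain ⟨C, δ, hC, hδ, hnear⟩ := h.exists_norm_exp_sub_le
  obtain ⟨S, hS, hsum⟩ := h.exists_sum_theta_le
  set B : ℝ := Real.exp 1 * 8 * S with hB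
  have hB0 : 0 ≤ B := by positivity
  refine ⟨C * Real.exp B + Real.exp K * (Real.exp 1 * S * Real.exp B), δ, by positivity, hδ,
    fun d hd D hD z hz hzδ hzd hzn => ?_⟩
  have hd0 : (0 : ℝ) < d := by positivity
  have hd1 : (1 : ℝ) ≤ d := by exact_mod_cast hd
  have hne : 1 - z ≠ 0 := Complex.slitPlane_ne_zero (one_sub_mem_slitPlane h.angle_pos hz)
  have hpos : 0 < ‖1 - z‖ := norm_pos_iff.2 hne
  set u : ℂ := (L θ D 1 : ℝ) - complexL θ D z with hu
  have hu1 : ‖u‖ ≤ Real.exp 1 * S * d * ‖1 - z‖ := by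
    rw [hu, norm_sub_rev]
    refine (norm_complexL_sub_le h.nonneg hD hzn).trans ?_
    rw [norm_sub_rev]
    calc _ ≤ Real.exp 1 * ‖1 - z‖ * (S * d) := by gcongr; exact hsum d hd
      _ = _ := by ring
  have hu2 : ‖u‖ ≤ B := by
    refine hu1.trans ?_
    calc _ ≤ Real.exp 1 * S * d * (8 / d) := by gcongr
      _ = _ := by rw [hB]; field_simp
  have hexpu : ‖Complex.exp u‖ ≤ Real.exp B := by
    rw [Complex.norm_exp]
    exact Real.exp_le_exp.2 ((Complex.re_le_norm u).trans hu2)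
  have hexpu1 : ‖Complex.exp u - 1‖ ≤ Real.exp 1 * S * d * ‖1 - z‖ * Real.exp B := by
    refine (norm_exp_sub_one_le_mul_exp u).trans ?_
    gcongr
  -- The first summand is the error of replacing `exp g` by its singular part, the second the error
  -- of replacing `L_D z` by `L_D 1`. Only the second costs a factor `d`.
  have hdec : remainder θ ϑ K g D z =
      (Complex.exp (g z) - Real.exp K * (1 - z) ^ (-(ϑ : ℂ))) * Complex.exp u +
        Real.exp K * (1 - z) ^ (-(ϑ : ℂ)) * (Complex.exp u - 1) := by
    have e : Complex.exp (L θ D 1 : ℝ) * Complex.exp (g z - complexL θ D z) =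
        Complex.exp (g z) * Complex.exp u := by
      rw [← Complex.exp_add, ← Complex.exp_add, hu]
      congr 1
      ring
    rw [remainder, e]
    ring
  have hrpow : ‖1 - z‖ ^ (-ϑ) * ‖1 - z‖ = ‖1 - z‖ ^ (1 - ϑ) := by
    rw [← Real.rpow_add_one hpos.ne', show -ϑ + 1 = 1 - ϑ by ring]
  rw [hdec]
  refine (norm_add_le _ _).trans ?_
  rw [norm_mul, norm_mul, norm_mul, Complex.norm_real, Real.norm_of_nonneg (Real.exp_pos K).le,
    ← Complex.ofReal_neg, Complex.norm_cpow_real, Complex.ofReal_neg]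
  have h1 := hnear z hz hzδ
  calc _ ≤ C * ‖1 - z‖ ^ (1 - ϑ) * Real.exp B + Real.exp K * ‖1 - z‖ ^ (-ϑ) *
        (Real.exp 1 * S * d * ‖1 - z‖ * Real.exp B) := by gcongr
    _ = C * Real.exp B * 1 * ‖1 - z‖ ^ (1 - ϑ) + Real.exp K * (Real.exp 1 * S * Real.exp B) * d *
        (‖1 - z‖ ^ (-ϑ) * ‖1 - z‖) := by ring
    _ ≤ C * Real.exp B * d * ‖1 - z‖ ^ (1 - ϑ) + Real.exp K * (Real.exp 1 * S * Real.exp B) * d *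
        (‖1 - z‖ ^ (-ϑ) * ‖1 - z‖) := by gcongr
    _ = _ := by rw [hrpow]; ring

theorem exists_norm_remainder_le_far (h : SingularityData θ ϑ K g R φ) {c : ℝ} (hc : 1 ≤ c)
    (hexp : ∀ w ∈ logDisc c, Complex.exp w ∈ Delta0 1 R φ) :
    ∃ C q : ℝ, 0 ≤ C ∧ 0 ≤ q ∧ ∀ d : ℕ, 1 ≤ d → ∀ D ⊆ Icc 1 d, ∀ b : ℝ, 0 < b → b ≤ 1 / d →
      ∀ w : ℂ, -1 ≤ w.re → w.re ≤ b / c → b ≤ w.im → w.im ≤ 2 * Real.pi - b →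
      ‖remainder θ ϑ K g D (Complex.exp w)‖ ≤ C * (d : ℝ) ^ q * (b / 4) ^ (-ϑ) := by
  obtain ⟨C, hC, hbound⟩ := h.exists_norm_exp_le hc hexp
  obtain ⟨S, hS, hsum⟩ := h.exists_sum_theta_div_le
  have hϑ := h.exponent_pos
  have hc0 : 0 < c := by linarith
  -- Both `L_D 1` and `L_D z` are at most `e S (1 + log d)` in norm, so the exponential of their
  -- difference is at most `e^q d^q`.
  set q : ℝ := 2 * (Real.exp 1 * S) with hq
  have hq0 : 0 ≤ q := by positivity
  refine ⟨C * Real.exp q + Real.exp K, q, by positivity, hq0,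
    fun d hd D hD b hb0 hbd w hre1 hre2 him1 him2 => ?_⟩
  have hd0 : (0 : ℝ) < d := by positivity
  have hd1 : (1 : ℝ) ≤ d := by exact_mod_cast hd
  have hb1 : b ≤ 1 := hbd.trans (by rw [div_le_one hd0]; exact hd1)
  have hlow := le_norm_one_sub_exp hb0.le hb1 hre1 him1 him2
  have hpos : 0 < ‖1 - Complex.exp w‖ := lt_of_lt_of_le (by positivity) hlow
  have hcre : c * w.re ≤ b := by
    rw [le_div_iff₀ hc0] at hre2
    linarith
  have h1 := hbound w hre1 (hre2.trans (by gcongr)) (by linarith) (by linarith) (by linarith)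
    (by linarith) (fun he => by rw [he] at hpos; simp at hpos)
  have hpow : ‖1 - Complex.exp w‖ ^ (-ϑ) ≤ (b / 4) ^ (-ϑ) :=
    Real.rpow_le_rpow_of_nonpos (by positivity) hlow (by linarith)
  have hzn : ‖Complex.exp w‖ ≤ Real.exp (1 / d) := by
    rw [Complex.norm_exp]
    apply Real.exp_le_exp.2
    exact hre2.trans ((div_le_self hb0.le hc).trans hbd)
  have hL1 : ‖complexL θ D (Complex.exp w)‖ ≤ Real.exp 1 * (S * (1 + Real.log d)) := by
    refine (norm_complexL_le h.nonneg hD hzn).trans ?_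
    gcongr
    exact hsum d hd
  have hL2 : ‖((L θ D 1 : ℝ) : ℂ)‖ ≤ Real.exp 1 * (S * (1 + Real.log d)) := by
    have e : ((L θ D 1 : ℝ) : ℂ) = complexL θ D 1 := by simp [L, complexL]
    rw [e]
    refine (norm_complexL_le h.nonneg hD (z := 1) ?_).trans ?_
    · rw [norm_one]
      exact Real.one_le_exp (by positivity)
    · gcongr
      exact hsum d hd
  have hQ : ‖Complex.exp ((L θ D 1 : ℝ) - complexL θ D (Complex.exp w))‖ ≤
      Real.exp q * (d : ℝ) ^ q := by
    rw [Complex.norm_exp, Real.rpow_def_of_pos hd0, ← Real.exp_add]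
    apply Real.exp_le_exp.2
    refine (Complex.re_le_norm _).trans ((norm_sub_le _ _).trans ?_)
    rw [hq]
    linarith
  have hdq : 1 ≤ (d : ℝ) ^ q := Real.one_le_rpow hd1 hq0
  have e : Complex.exp (L θ D 1 : ℝ) *
      Complex.exp (g (Complex.exp w) - complexL θ D (Complex.exp w)) =
      Complex.exp (g (Complex.exp w)) *
        Complex.exp ((L θ D 1 : ℝ) - complexL θ D (Complex.exp w)) := by
    rw [← Complex.exp_add, ← Complex.exp_add]
    congr 1
    ring
  rw [remainder, e]
  refine (norm_sub_le _ _).trans ?_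
  rw [norm_mul, norm_mul, Complex.norm_real, Real.norm_of_nonneg (Real.exp_pos K).le,
    ← Complex.ofReal_neg, Complex.norm_cpow_real]
  calc _ ≤ C * (b / 4) ^ (-ϑ) * (Real.exp q * (d : ℝ) ^ q) + Real.exp K * (b / 4) ^ (-ϑ) := by
        gcongr
        exact h1.trans (by gcongr)
    _ ≤ C * (b / 4) ^ (-ϑ) * (Real.exp q * (d : ℝ) ^ q) +
        Real.exp K * (b / 4) ^ (-ϑ) * (d : ℝ) ^ q := by
      have : 0 ≤ Real.exp K * (b / 4) ^ (-ϑ) := by positivity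
      nlinarith
    _ = _ := by ring

/-- Bound for the Taylor coefficients of the remainder, uniform in `D ⊆ {1, …, d}`. -/
theorem exists_norm_taylorCoeff_remainder_le (h : SingularityData θ ϑ K g R φ) :
    ∃ (C k q : ℝ) (N : ℕ), 0 ≤ C ∧ 0 < k ∧ 0 ≤ q ∧ 1 ≤ N ∧ ∀ n ≥ N, ∀ d : ℕ, 1 ≤ d → d ≤ n →
      ∀ D ⊆ Icc 1 d, ‖taylorCoeff (remainder θ ϑ K g D) n‖ ≤
        C * (d * (n : ℝ) ^ (ϑ - 2) + (n : ℝ) ^ q * Real.exp (-(k * (n / d)))) := by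
  obtain ⟨c, hc, hexp⟩ := exists_exp_mem_Delta0 h.one_lt h.angle_pos h.angle_lt
  obtain ⟨C₁, δ, hC₁, hδ, hnear⟩ := h.exists_norm_remainder_le_near
  obtain ⟨C₂, q, hC₂, hq, hfar⟩ := h.exists_norm_remainder_le_far hc hexp
  have hϑ := h.exponent_pos
  have hc0 : 0 < c := by linarith
  obtain ⟨C₃, hC₃, hpe⟩ := exists_one_add_rpow_le_exp (1 - ϑ) (k := 1 / (2 * c)) (by positivity)
  -- On the slanted segments `s ≤ β / d` and `1/n ≤ β`, so `s + 1/n ≤ 2β`. This is at most `1/4`, as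
  -- the comparison of `e^w - 1` with `w` requires, and keeps `|1 - e^w| ≤ 8β` below `δ`.
  set β : ℝ := min (1 / 8) (δ / 16) with hβ
  have hβ0 : 0 < β := by positivity
  have hβ8 : β ≤ 1 / 8 := min_le_left _ _
  have hβδ : β ≤ δ / 16 := min_le_right _ _
  obtain ⟨N, hN⟩ := exists_nat_ge (1 / β)
  set C₄ : ℝ := C₁ * (6 ^ |1 - ϑ| * C₃) with hC₄
  have hC₄0 : 0 ≤ C₄ := by positivity
  set C₅ : ℝ := C₂ * (β / 4) ^ (-ϑ) with hC₅
  have hC₅0 : 0 ≤ C₅ := by positivity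
  refine ⟨8 * Real.exp 1 * c * C₄ + Real.exp 1 * C₅, β / c, q + ϑ, max N 1, by positivity,
    by positivity, by positivity, le_max_right _ _, fun n hn d hd hdn D hD => ?_⟩
  have hn1 : 1 ≤ n := (le_max_right _ _).trans hn
  have hn0 : (0 : ℝ) < n := by positivity
  have hnR : (1 : ℝ) ≤ n := by exact_mod_cast hn1
  have hd0 : (0 : ℝ) < d := by positivity
  have hd1 : (1 : ℝ) ≤ d := by exact_mod_cast hd
  have hdnR : (d : ℝ) ≤ n := by exact_mod_cast hdn
  have hnβ : 1 / (n : ℝ) ≤ β := by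
    rw [div_le_comm₀ hn0 hβ0]
    refine hN.trans ?_
    exact_mod_cast (le_max_left _ _).trans hn
  have hndd : 1 / (n : ℝ) ≤ 1 / d := one_div_le_one_div_of_le hd0 hdnR
  have hn1' : 1 / (n : ℝ) ≤ 1 := by rw [div_le_one hn0]; exact hnR
  -- The contour leaves the singularity up to scale `1/d`: `|z| ≤ e^{1/d}` keeps `L_D` under
  -- control, while `|z^{-n}|` still drops to order `exp (-(β/c) n/d)`.
  set b : ℝ := β / d with hb
  have hb0 : 0 < b := by positivity
  have hbβ : b ≤ β := div_le_self hβ0.le hd1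
  have hbd : b ≤ 1 / d := by
    rw [hb]; gcongr; linarith
  have key := norm_taylorCoeff_le h.one_lt h.angle_pos h.angle_lt (h.differentiableOn_remainder D)
    hc hexp hn1 (b := b) (M₁ := C₄ * d * (n : ℝ) ^ (ϑ - 1)) (M₂ := C₅ * (n : ℝ) ^ (q + ϑ))
    hb0.le (by linarith) (by positivity) (by positivity) ?_ ?_
  · refine key.trans ?_
    have e1 : C₄ * d * (n : ℝ) ^ (ϑ - 1) / n = C₄ * (d * (n : ℝ) ^ (ϑ - 2)) := by
      rw [show ϑ - 2 = ϑ - 1 - 1 by ring, Real.rpow_sub_one hn0.ne' (ϑ - 1)]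
      ring
    have e2 : (n : ℝ) * b / c = β / c * (n / d) := by
      rw [hb]; ring
    rw [e1, e2]
    set X := (d : ℝ) * (n : ℝ) ^ (ϑ - 2)
    set Y := Real.exp (-(β / c * (n / d)))
    set Z := (n : ℝ) ^ (q + ϑ)
    have hX : 0 ≤ X := by positivity
    have hYZ : 0 ≤ Z * Y := by positivity
    have p1 : 0 ≤ 8 * Real.exp 1 * c * C₄ * (Z * Y) := by positivity
    have p2 : 0 ≤ Real.exp 1 * C₅ * X := by positivity
    calc _ = 8 * Real.exp 1 * c * C₄ * X + Real.exp 1 * C₅ * (Z * Y) := by ring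
      _ ≤ 8 * Real.exp 1 * c * C₄ * X + Real.exp 1 * C₅ * (Z * Y) +
        (8 * Real.exp 1 * c * C₄ * (Z * Y) + Real.exp 1 * C₅ * X) := by linarith
      _ = _ := by ring
  · rintro s ⟨hs0, hsb⟩ w hre him
    have hpi := Real.pi_gt_three
    have hn2 : (0 : ℝ) < 1 / n := by positivity
    have hmem : w ∈ logDisc c := by
      refine mem_logDisc_of_re_eq hc hs0 (by linarith) hn2 hn1' hre ?_ ?_
      · rcases him with h | h <;> linarith
      · rcases him with h | h <;> linarith
    have hcomp : (s + 1 / n) / 6 ≤ ‖1 - Complex.exp w‖ ∧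
        ‖1 - Complex.exp w‖ ≤ 4 * (s + 1 / n) := by
      rw [norm_sub_rev]
      rcases him with h | h
      · exact norm_exp_sub_one_comparable hc hs0 hn2 (by linarith) hre
          (by rw [h, abs_of_nonneg hs0])
      -- By periodicity the upper segment, starting near `2πi`, reduces to one near `0`.
      · have e : Complex.exp w = Complex.exp (w - 2 * Real.pi * Complex.I) := by
          rw [Complex.exp_sub, Complex.exp_two_pi_mul_I, div_one]
        rw [e]
        refine norm_exp_sub_one_comparable hc hs0 hn2 (by linarith) (by simpa using hre) ?_
        have : (w - 2 * Real.pi * Complex.I).im = -s := by simp [h]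
        rw [this, abs_neg, abs_of_nonneg hs0]
    have hX : 0 < s + 1 / (n : ℝ) := by positivity
    have h1 := hnear d hd D hD (Complex.exp w) (hexp w hmem) (by linarith) (by
      refine hcomp.2.trans ?_
      have : (8 : ℝ) / d = 4 * (1 / d + 1 / d) := by ring
      rw [this]
      linarith) (by
      rw [Complex.norm_exp, hre]
      apply Real.exp_le_exp.2
      have := div_le_self hs0 hc
      linarith)
    have h2 := rpow_le_of_comparable hX hcomp.1 (by linarith) (1 - ϑ)
    have h3 : (s + 1 / (n : ℝ)) ^ (1 - ϑ) ≤
        (n : ℝ) ^ (ϑ - 1) * (C₃ * Real.exp (n * s / (2 * c))) := by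
      have e : s + 1 / (n : ℝ) = (n : ℝ)⁻¹ * (1 + n * s) := by field_simp; ring
      rw [e, Real.mul_rpow (by positivity) (by positivity), Real.inv_rpow hn0.le,
        ← Real.rpow_neg hn0.le, show -(1 - ϑ) = ϑ - 1 by ring]
      have := hpe (n * s) (by positivity)
      rw [show 1 / (2 * c) * (n * s) = n * s / (2 * c) by ring] at this
      gcongr
    calc _ ≤ C₁ * d * ‖1 - Complex.exp w‖ ^ (1 - ϑ) := h1
      _ ≤ C₁ * d * (6 ^ |1 - ϑ| * ((n : ℝ) ^ (ϑ - 1) * (C₃ * Real.exp (n * s / (2 * c))))) := by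
        gcongr
        exact h2.trans (by gcongr)
      _ = _ := by rw [hC₄]; ring
  · intro w hre him1 him2
    have h1 := hfar d hd D hD b hb0 hbd w (by
      rw [hre]
      have : 0 ≤ b / c := by positivity
      linarith) (by
      rw [hre]
      have : (0 : ℝ) < 1 / n := by positivity
      linarith) him1 him2
    refine h1.trans ?_
    have e : (b / 4) ^ (-ϑ) = (β / 4) ^ (-ϑ) * (d : ℝ) ^ ϑ := by
      rw [show b / 4 = β / 4 * (d : ℝ)⁻¹ by rw [hb]; ring,
        Real.mul_rpow (by positivity) (by positivity), Real.inv_rpow hd0.le,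
        ← Real.rpow_neg hd0.le, neg_neg]
    rw [e, Real.rpow_add hn0]
    calc _ = C₅ * ((d : ℝ) ^ q * (d : ℝ) ^ ϑ) := by rw [hC₅]; ring
      _ ≤ _ := by gcongr

/-- Up to order `n`, the coefficients of `g - L_D` are `θ m / m` on `A` and `0` off `A`, which is
all that the exponential formula for `h_n(A)` sees. -/
theorem taylorCoeff_remainder (h : SingularityData θ ϑ K g R φ) (n : ℕ) (A : Finset ℕ) :
    taylorCoeff (remainder θ ϑ K g (compl n A)) n =
      ((Real.exp (L θ (compl n A) 1) * normConst θ n A : ℝ) : ℂ) -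
        Real.exp K * taylorCoeff (fun z => (1 - z) ^ (-(ϑ : ℂ))) n := by
  set D := compl n A with hD
  have hball : Metric.ball (0 : ℂ) 1 ∈ 𝓝 (0 : ℂ) := Metric.ball_mem_nhds 0 one_pos
  have hsub := ball_subset_Delta0 h.one_lt h.angle_pos h.angle_lt
  have hnhds : Delta0 1 R φ ∈ 𝓝 (0 : ℂ) := Filter.mem_of_superset hball hsub
  have han1 := ((h.differentiableOn_exp_sub D).analyticAt hnhds).contDiffAt (n := n)
  have han2 := ((differentiableOn_one_sub_cpow (R := R) (a := -(ϑ : ℂ))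
    h.angle_pos).analyticAt hnhds).contDiffAt (n := n)
  have hlin : taylorCoeff (remainder θ ϑ K g D) n =
      Complex.exp (L θ D 1 : ℝ) * taylorCoeff (fun z => Complex.exp (g z - complexL θ D z)) n -
        Real.exp K * taylorCoeff (fun z => (1 - z) ^ (-(ϑ : ℂ))) n := by
    unfold taylorCoeff
    have e : remainder θ ϑ K g D =
        (fun z => Complex.exp (L θ D 1 : ℝ) * Complex.exp (g z - complexL θ D z)) -
          fun z => (Real.exp K : ℂ) * (1 - z) ^ (-(ϑ : ℂ)) := rfl
    rw [e, iteratedDeriv_sub (contDiffAt_const.mul han1) (contDiffAt_const.mul han2),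
      iteratedDeriv_const_mul_field, iteratedDeriv_const_mul_field]
    ring
  have hcoef := taylorCoeff_exp_eq_normConst (f := fun z => g z - complexL θ D z)
    (c := fun m => ((θ m / m : ℝ) : ℂ) - if m ∈ D then ((θ m / m : ℝ) : ℂ) else 0) θ A n ?_ ?_ ?_
    n le_rfl
  · rw [hlin, hcoef]
    push_cast
    rfl
  · filter_upwards [h.hasSum] with z hz
    simp_rw [sub_mul]
    refine hz.sub ?_
    have := hasSum_sum_of_ne_finset_zero (L := SummationFilter.unconditional ℕ) (s := D)
      (f := fun m => (if m ∈ D then ((θ m / m : ℝ) : ℂ) else 0) * z ^ m)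
      (fun m hm => by simp [hm])
    have e : complexL θ D z = ∑ m ∈ D, (if m ∈ D then ((θ m / m : ℝ) : ℂ) else 0) * z ^ m :=
      Finset.sum_congr rfl fun m hm => by rw [if_pos hm]
    rw [e]
    exact this
  · simp
  · intro m hm1 hmn
    have hm0 : (m : ℂ) ≠ 0 := by
      rw [Nat.cast_ne_zero]; omega
    by_cases hmA : m ∈ A
    · have : m ∉ D := by simp [hD, compl, hmA]
      simp only [this, hmA, if_true, if_false, sub_zero]
      push_cast
      field_simp
    · have : m ∈ D := by simp [hD, compl, hmA, hm1, hmn]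
      simp [this, hmA]

/-- The asymptotics of the normalization constants with an explicit uniform error term. -/
theorem exists_abs_normConst_sub_le (h : SingularityData θ ϑ K g R φ) :
    ∃ (C k q : ℝ) (N : ℕ), 0 ≤ C ∧ 0 < k ∧ 0 ≤ q ∧ 1 ≤ N ∧ ∀ n ≥ N, ∀ d : ℕ, 1 ≤ d → d ≤ n →
      ∀ A : Finset ℕ, compl n A ⊆ Icc 1 d →
        |Real.exp (L θ (compl n A) 1) * normConst θ n A -
          Real.exp K * ((n : ℝ) ^ (ϑ - 1) / Real.Gamma ϑ)| ≤
        C * (d * (n : ℝ) ^ (ϑ - 2) + (n : ℝ) ^ q * Real.exp (-(k * (n / d)))) := by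
  obtain ⟨C, k, q, N, hC, hk, hq, hN, hb⟩ := h.exists_norm_taylorCoeff_remainder_le
  obtain ⟨C', hC', hb'⟩ := exists_taylorCoeff_one_sub_cpow_neg_bound h.exponent_pos
  refine ⟨C + Real.exp K * C', k, q, N, by positivity, hk, hq, hN, fun n hn d hd hdn A hA => ?_⟩
  have h1 := hb n hn d hd hdn _ hA
  have h2 := hb' n (hN.trans hn)
  have hn0 : (0 : ℝ) < n := by exact_mod_cast (by omega : 0 < n)
  have hd1 : (1 : ℝ) ≤ d := by exact_mod_cast hd
  rw [h.taylorCoeff_remainder] at h1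
  set τ := taylorCoeff (fun z => (1 - z) ^ (-(ϑ : ℂ))) n
  have e : ((Real.exp (L θ (compl n A) 1) * normConst θ n A -
      Real.exp K * ((n : ℝ) ^ (ϑ - 1) / Real.Gamma ϑ) : ℝ) : ℂ) =
      (((Real.exp (L θ (compl n A) 1) * normConst θ n A : ℝ) : ℂ) - Real.exp K * τ) +
        Real.exp K * (τ - (((n : ℝ) ^ (ϑ - 1) / Real.Gamma ϑ : ℝ) : ℂ)) := by
    rw [Complex.ofReal_sub, Complex.ofReal_mul (Real.exp K)]
    ring
  rw [← Real.norm_eq_abs, ← Complex.norm_real, e]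
  refine (norm_add_le _ _).trans ?_
  rw [norm_mul, Complex.norm_real (Real.exp K), Real.norm_of_nonneg (Real.exp_pos K).le]
  have hp : 0 ≤ (n : ℝ) ^ (ϑ - 2) := by positivity
  have hq' : 0 ≤ (n : ℝ) ^ q * Real.exp (-(k * (n / d))) := by positivity
  have h3 : Real.exp K * ‖τ - (((n : ℝ) ^ (ϑ - 1) / Real.Gamma ϑ : ℝ) : ℂ)‖ ≤
      Real.exp K * C' * (d * (n : ℝ) ^ (ϑ - 2) + (n : ℝ) ^ q * Real.exp (-(k * (n / d)))) := by
    calc _ ≤ Real.exp K * (C' * (n : ℝ) ^ (ϑ - 2)) := by gcongr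
      _ = Real.exp K * C' * (1 * (n : ℝ) ^ (ϑ - 2)) := by ring
      _ ≤ _ := by
        gcongr
        have : 1 * (n : ℝ) ^ (ϑ - 2) ≤ d * (n : ℝ) ^ (ϑ - 2) := by gcongr
        linarith
  rw [add_mul]
  exact add_le_add h1 h3

end SingularityData

/-! ### Rescaling to `r = 1` -/

theorem weight_mul_pow (θ : ℕ → ℝ) (r : ℝ) (A : Finset ℕ) {n : ℕ} (σ : Equiv.Perm (Fin n)) :
    weight (fun m => θ m * r ^ m) A σ = r ^ n * weight θ A σ := by
  unfold weight
  have e : ∀ m : ℕ, (if m ∈ A then θ m * r ^ m else 0) = r ^ m * (if m ∈ A then θ m else 0) := by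
    intro m
    split_ifs <;> ring
  simp_rw [e]
  rw [Multiset.prod_map_mul]
  congr 1
  have h : ∀ s : Multiset ℕ, (s.map fun m => r ^ m).prod = r ^ s.sum := by
    intro s
    induction s using Multiset.induction_on with
    | empty => simp
    | cons a s ih => rw [Multiset.map_cons, Multiset.prod_cons, ih, Multiset.sum_cons, pow_add]
  rw [h, σ.partition.parts_sum, Fintype.card_fin]

theorem normConst_mul_pow (θ : ℕ → ℝ) (r : ℝ) (n : ℕ) (A : Finset ℕ) :
    normConst (fun m => θ m * r ^ m) n A = r ^ n * normConst θ n A := by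
  simp_rw [normConst, weight_mul_pow]
  rw [← Finset.mul_sum, mul_div_assoc]

theorem L_mul_pow (θ : ℕ → ℝ) (r : ℝ) (D : Finset ℕ) :
    L (fun m => θ m * r ^ m) D 1 = L θ D r := by
  unfold L
  refine Finset.sum_congr rfl fun m _ => ?_
  rw [one_pow]
  ring

theorem mul_mem_Delta0 {r R φ : ℝ} (hr : 0 < r) {z : ℂ} (hz : z ∈ Delta0 1 (R / r) φ) :
    (r : ℂ) * z ∈ Delta0 r R φ := by
  obtain ⟨h1, h2, h3⟩ := hz
  rw [Complex.ofReal_one] at h2 h3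
  have hr' : (r : ℂ) ≠ 0 := Complex.ofReal_ne_zero.2 hr.ne'
  refine ⟨?_, ?_, ?_⟩
  · rw [norm_mul, Complex.norm_real, Real.norm_of_nonneg hr.le]
    rwa [lt_div_iff₀ hr, mul_comm] at h1
  · intro h
    exact h2 (mul_left_cancel₀ hr' (h.trans (mul_one _).symm))
  · rwa [show (r : ℂ) * z - r = r * (z - 1) by ring, Complex.arg_real_mul _ hr]

/-- Rescaling to radius of convergence `1`. -/
theorem GThetaMem.exists_singularityData {θ : ℕ → ℝ} (hθ : ∀ m : ℕ, 1 ≤ m → 0 ≤ θ m)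
    {r ϑ K : ℝ} (hr : 0 < r) (hϑ : 0 < ϑ) (hg : GThetaMem θ r ϑ K) :
    ∃ (g : ℂ → ℂ) (R φ : ℝ), SingularityData (fun m => θ m * r ^ m) ϑ K g R φ := by
  obtain ⟨g, ⟨R, φ, hR, h0, h1, hd, hO⟩, hs⟩ := hg
  have hr' : (r : ℂ) ≠ 0 := Complex.ofReal_ne_zero.2 hr.ne'
  refine ⟨fun z => g (r * z), R / r, φ, ?_⟩
  constructor
  · intro m hm
    have := hθ m hm
    positivity
  · exact hϑ
  · rwa [one_lt_div hr]
  · exact h0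
  · exact h1
  · exact hd.comp (by fun_prop) fun z hz => mul_mem_Delta0 hr hz
  · obtain ⟨C, hC, hb⟩ := hO.exists_nonneg
    rw [IsBigOWith, eventually_nhdsWithin_iff, Metric.eventually_nhds_iff] at hb
    obtain ⟨δ, hδ, hb⟩ := hb
    refine ⟨C * r, δ / r, by positivity, by positivity, fun z hz hzδ => ?_⟩
    have hn : ‖(r : ℂ) * z - r‖ = r * ‖z - 1‖ := by
      rw [show (r : ℂ) * z - r = r * (z - 1) by ring, norm_mul, Complex.norm_real,
        Real.norm_of_nonneg hr.le]
    have h2 := hb (y := (r : ℂ) * z) (by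
      rw [dist_eq_norm, hn]
      rwa [lt_div_iff₀ hr, mul_comm] at hzδ) (mul_mem_Delta0 hr hz)
    rw [hn, mul_div_cancel_left₀ z hr', ← mul_assoc] at h2
    exact h2
  · have ht : Tendsto (fun z : ℂ => (r : ℂ) * z) (𝓝 0) (𝓝 0) := by
      have : Continuous fun z : ℂ => (r : ℂ) * z := by fun_prop
      simpa using this.tendsto 0
    filter_upwards [ht.eventually hs] with z hz
    -- The series in the hypothesis starts at `m = 1`; the added term `m = 0` vanishes because its
    -- denominator is `0`.
    rw [← hasSum_nat_add_iff' 1]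
    simp only [Finset.sum_range_one, Nat.cast_zero, div_zero, Complex.ofReal_zero, zero_mul,
      sub_zero]
    refine hz.congr_fun fun k => ?_
    push_cast
    rw [mul_pow]
    ring

/-! ### The growth condition -/

/-- Eventually `n / d n ≥ (|C| + 1) log n`, which leaves at most `-log n`. Both special cases of the
theorem reduce to this criterion. -/
theorem growth_of_isLittleO {d : ℕ → ℕ} (hd : ∀ n, 1 ≤ d n)
    (h : (fun n : ℕ => (d n : ℝ) * Real.log n) =o[atTop] fun n : ℕ => (n : ℝ)) : Growth d := by
  intro C
  have hlog : Tendsto (fun n : ℕ => -Real.log (n : ℝ)) atTop atBot :=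
    tendsto_neg_atTop_atBot.comp (Real.tendsto_log_atTop.comp tendsto_natCast_atTop_atTop)
  refine tendsto_atBot_mono' _ ?_ hlog
  have hM : 0 < |C| + 1 := by positivity
  filter_upwards [h.bound (inv_pos.2 hM)] with n hn
  have hd0 : (0 : ℝ) < d n := by exact_mod_cast hd n
  have hl : 0 ≤ Real.log n := Real.log_natCast_nonneg n
  rw [Real.norm_of_nonneg (by positivity), Real.norm_of_nonneg (by positivity),
    inv_mul_eq_div, le_div_iff₀ hM] at hn
  have h2 : (|C| + 1) * Real.log n ≤ n / d n := by
    rw [le_div_iff₀ hd0]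
    linarith
  nlinarith [le_abs_self C]

theorem growth_of_isEquivalent_log {d : ℕ → ℕ} (hd : ∀ n, 1 ≤ d n)
    (h : (fun n : ℕ => (d n : ℝ)) ~[atTop] fun n : ℕ => Real.log (n : ℝ)) : Growth d := by
  refine growth_of_isLittleO hd ?_
  refine (h.isBigO.mul (isBigO_refl (fun n : ℕ => Real.log (n : ℝ)) atTop)).trans_isLittleO ?_
  have := (Real.isLittleO_pow_log_id_atTop (n := 2)).comp_tendsto
    (tendsto_natCast_atTop_atTop (R := ℝ))
  refine this.congr_left fun n => ?_
  simp [pow_two]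

theorem growth_of_isEquivalent_rpow {d : ℕ → ℕ} (hd : ∀ n, 1 ≤ d n) {α : ℝ} (hα : α < 1)
    (h : (fun n : ℕ => (d n : ℝ)) ~[atTop] fun n : ℕ => (n : ℝ) ^ α) : Growth d := by
  refine growth_of_isLittleO hd ?_
  have hlog := (isLittleO_log_rpow_atTop (r := 1 - α) (by linarith)).comp_tendsto
    (tendsto_natCast_atTop_atTop (R := ℝ))
  refine (h.isBigO.mul_isLittleO hlog).congr' EventuallyEq.rfl ?_
  filter_upwards [eventually_ge_atTop 1] with n hn
  have hn0 : (0 : ℝ) < n := by positivity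
  simp only [Function.comp]
  rw [← Real.rpow_add hn0]
  simp

/-- Taking `C = (q - a) / k` in the growth condition yields `n^(q-a) ≤ e^{k n / d}`. Thus the far
part of the contour is absorbed into the near part. -/
theorem Growth.eventually_le {d : ℕ → ℕ} (hG : Growth d) (hd : ∀ n, 1 ≤ d n) {k : ℝ} (hk : 0 < k)
    (q a : ℝ) : ∀ᶠ n : ℕ in atTop,
      (n : ℝ) ^ q * Real.exp (-(k * (n / d n))) ≤ d n * (n : ℝ) ^ a := by
  filter_upwards [(hG ((q - a) / k)).eventually_le_atBot 0, eventually_ge_atTop 1] with n hn hn1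
  have hn0 : (0 : ℝ) < n := by positivity
  have hdn : (1 : ℝ) ≤ d n := by exact_mod_cast hd n
  have h1 : (q - a) * Real.log n ≤ k * (n / d n) := by
    have : (q - a) / k * Real.log n ≤ n / d n := by linarith
    calc (q - a) * Real.log n = k * ((q - a) / k * Real.log n) := by field_simp
      _ ≤ _ := by gcongr
  have h2 : (n : ℝ) ^ q * Real.exp (-(k * (n / d n))) ≤ (n : ℝ) ^ a := by
    rw [Real.rpow_def_of_pos hn0, Real.rpow_def_of_pos hn0, ← Real.exp_add]
    apply Real.exp_le_exp.2
    linarith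
  have h3 : 0 ≤ (n : ℝ) ^ a := by positivity
  nlinarith

/-! ### Conclusion -/

theorem one_le_maxOrOne {D : Finset ℕ} {n : ℕ} (hD : D ⊆ Icc 1 n) : 1 ≤ maxOrOne D := by
  unfold maxOrOne
  split_ifs with h
  · exact (Finset.mem_Icc.1 (hD (D.max'_mem h))).1
  · exact le_rfl

theorem maxOrOne_le {D : Finset ℕ} {n : ℕ} (hn : 1 ≤ n) (hD : D ⊆ Icc 1 n) : maxOrOne D ≤ n := by
  unfold maxOrOne
  split_ifs with h
  · exact (Finset.mem_Icc.1 (hD (D.max'_mem h))).2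
  · exact hn

theorem subset_Icc_maxOrOne {D : Finset ℕ} {n : ℕ} (hD : D ⊆ Icc 1 n) :
    D ⊆ Icc 1 (maxOrOne D) := by
  intro m hm
  have hne : D.Nonempty := ⟨m, hm⟩
  rw [maxOrOne, dif_pos hne, Finset.mem_Icc]
  exact ⟨(Finset.mem_Icc.1 (hD hm)).1, D.le_max' m hm⟩

theorem exists_normConst_eq {θ : ℕ → ℝ} (hθ : ∀ m : ℕ, 1 ≤ m → 0 ≤ θ m) {r ϑ K : ℝ} (hr : 0 < r)
    (hϑ : 0 < ϑ) (hg : GThetaMem θ r ϑ K) (A : ℕ → Finset ℕ)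
    (hG : Growth fun n => maxOrOne (compl n (A n))) :
    ∃ ε : ℕ → ℝ,
      (ε =O[atTop] fun n : ℕ => (maxOrOne (compl n (A n)) : ℝ) / (n : ℝ)) ∧
      ∀ n : ℕ, 1 ≤ n → normConst θ n (A n) =
        Real.exp (-L θ (compl n (A n)) r) *
          ((n : ℝ) ^ (ϑ - 1) * Real.exp K / (r ^ n * Real.Gamma ϑ)) * (1 + ε n) := by
  obtain ⟨g, R, φ, h⟩ := hg.exists_singularityData hθ hr hϑ
  obtain ⟨C, k, q, N, hC, hk, -, hN, hb⟩ := h.exists_abs_normConst_sub_le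
  have hΓ := Real.Gamma_pos_of_pos hϑ
  have hsub : ∀ n, compl n (A n) ⊆ Icc 1 n := fun n => Finset.sdiff_subset
  set d : ℕ → ℕ := fun n => maxOrOne (compl n (A n)) with hd
  have hd1 : ∀ n, 1 ≤ d n := fun n => one_le_maxOrOne (hsub n)
  set M : ℕ → ℝ := fun n => Real.exp K * ((n : ℝ) ^ (ϑ - 1) / Real.Gamma ϑ) with hM
  have hMpos : ∀ n : ℕ, 1 ≤ n → 0 < M n := fun n hn => by
    have : (0 : ℝ) < n := by positivity
    positivity
  -- `ε` is the ratio to the main term minus one, so the identity is algebra for every `n ≥ 1` and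
  -- only the bound on `ε` is asymptotic.
  refine ⟨fun n => Real.exp (L θ (compl n (A n)) r) * (r ^ n * normConst θ n (A n)) / M n - 1,
    ?_, fun n hn => ?_⟩
  · refine IsBigO.of_bound (2 * C * (Real.Gamma ϑ * Real.exp (-K))) ?_
    filter_upwards [hG.eventually_le hd1 hk q (ϑ - 2), eventually_ge_atTop N] with n hn1 hn2
    have hn : 1 ≤ n := hN.trans hn2
    have hn0 : (0 : ℝ) < n := by positivity
    have h1 := hb n hn2 (d n) (hd1 n) (maxOrOne_le hn (hsub n)) (A n)
      (subset_Icc_maxOrOne (hsub n))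
    rw [L_mul_pow, normConst_mul_pow] at h1
    have h2 : C * (d n * (n : ℝ) ^ (ϑ - 2) + (n : ℝ) ^ q * Real.exp (-(k * (n / d n)))) ≤
        C * (2 * (d n * (n : ℝ) ^ (ϑ - 2))) := by
      gcongr
      linarith
    have hMn := hMpos n hn
    rw [div_sub_one hMn.ne', norm_div, Real.norm_of_nonneg hMn.le, div_le_iff₀ hMn,
      Real.norm_of_nonneg (show (0 : ℝ) ≤ (maxOrOne (compl n (A n)) : ℝ) / n by positivity),
      Real.norm_eq_abs]
    refine (h1.trans h2).trans (le_of_eq ?_)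
    have e : Real.exp (-K) * Real.exp K = 1 := by rw [← Real.exp_add]; simp
    have e2 : (n : ℝ) ^ (ϑ - 2) = (n : ℝ) ^ (ϑ - 1) / n := by
      rw [← Real.rpow_sub_one hn0.ne' (ϑ - 1)]
      congr 1
      ring
    calc C * (2 * (d n * (n : ℝ) ^ (ϑ - 2))) =
        2 * C * (d n / n) * (n : ℝ) ^ (ϑ - 1) * (Real.exp (-K) * Real.exp K) := by
          rw [e, e2]; ring
      _ = _ := by
          simp only [hM, hd]
          field_simp
  · have hn0 : (0 : ℝ) < n := by positivity
    have hMn := hMpos n hn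
    have e : Real.exp (-L θ (compl n (A n)) r) * Real.exp (L θ (compl n (A n)) r) = 1 := by
      rw [← Real.exp_add]; simp
    have e2 : (n : ℝ) ^ (ϑ - 1) * Real.exp K / (r ^ n * Real.Gamma ϑ) = M n / r ^ n := by
      simp only [hM]
      field_simp
    have hrn : 0 < r ^ n := by positivity
    rw [e2, add_sub_cancel]
    calc normConst θ n (A n) = (Real.exp (-L θ (compl n (A n)) r) *
          Real.exp (L θ (compl n (A n)) r)) * normConst θ n (A n) := by rw [e, one_mul]
      _ = _ := by field_simp

end CycleWeights

end

theorem mainTheorem8 (θ : ℕ → ℝ) (hθ : ∀ m : ℕ, 1 ≤ m → 0 ≤ θ m)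
    (r ϑ K : ℝ) (hr : 0 < r) (hϑ : 0 < ϑ)
    (hg : CycleWeights.GThetaMem θ r ϑ K)
    (A : ℕ → Finset ℕ) (hA : ∀ n : ℕ, A n ⊆ Finset.Icc 1 n)
    (D : ℕ → Finset ℕ) (hD : ∀ n : ℕ, D n = CycleWeights.compl n (A n))
    (d : ℕ → ℕ) (hd : ∀ n : ℕ, d n = CycleWeights.maxOrOne (D n)) :
    (CycleWeights.Growth d →
      ∃ ε : ℕ → ℝ,
        (ε =O[atTop] fun n : ℕ => (d n : ℝ) / (n : ℝ)) ∧
        ∀ n : ℕ, 1 ≤ n →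
          CycleWeights.normConst θ n (A n) =
            Real.exp (-CycleWeights.L θ (D n) r) *
              ((n : ℝ) ^ (ϑ - 1) * Real.exp K / (r ^ n * Real.Gamma ϑ)) * (1 + ε n)) ∧
    (((fun n : ℕ => (d n : ℝ)) ~[atTop] fun n : ℕ => Real.log (n : ℝ)) →
      CycleWeights.Growth d) ∧
    (∀ α : ℝ, 0 < α → α < 1 →
      ((fun n : ℕ => (d n : ℝ)) ~[atTop] fun n : ℕ => (n : ℝ) ^ α) →
      CycleWeights.Growth d) := by
  obtain rfl : D = fun n => CycleWeights.compl n (A n) := funext hD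
  obtain rfl : d = fun n => CycleWeights.maxOrOne (CycleWeights.compl n (A n)) := funext hd
  have hd1 : ∀ n, 1 ≤ CycleWeights.maxOrOne (CycleWeights.compl n (A n)) := fun n =>
    CycleWeights.one_le_maxOrOne (n := n) Finset.sdiff_subset
  exact ⟨CycleWeights.exists_normConst_eq hθ hr hϑ hg A,
    CycleWeights.growth_of_isEquivalent_log hd1,
    fun α _ hα => CycleWeights.growth_of_isEquivalent_rpow hd1 hα⟩
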